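/- Let $(I,\preceq)$ be a finite partially ordered set. For $i,j\in I$ let $\mathcal A_{ij}$ be finite-dimensional real vector spaces with $\mathcal A_{ii}=\mathbb R$, $\mathcal A_{ij}=\{0\}$ if $i,j$ are incomparable, and $n_{ij}=\dim\mathcal A_{ij}>0$ if $j\prec i$. Let $\mathcal A=\prod_{i,j}\mathcal A_{ij}$ be a Vinberg algebra: it carries a matrix multiplication $(AB)_{ik}=\sum_j a_{ij}b_{jk}$ given by bilinear maps $\mathcal A_{ij}\times\mathcal A_{jk}\to\mathcal A_{ik}$, with unit $e=\mathrm{diag}(1,\dots,1)$, and a linear involution $A\mapsto A^*$ mapping the $(i,j)$ entry linearly into the $(j,i)$ entry and fixing diagonal entries, such that, with $\operatorname{tr}A=\sum_i a_{ii}$ and $\mathcal T_l=\{A: a_{ij}=0\text{ unless }j\preceq i\}$: (i) $\operatorname{tr}(AA^*)>0$ for $A\ne0$; (ii) $(AB)^*=B^*A^*$; (iii) $\operatorname{tr}(AB)=\operatorname{tr}(BA)$; (iv) $\operatorname{tr}(A(BC))=\operatorname{tr}((AB)C)$; (v) $(ST)U=S(TU)$ and (vi) $T(UU^*)=(TU)U^*$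 for $S,T,U\in\mathcal T_l$. Let $\mathcal H=\{A: A^*=A\}$, let $\mathcal T_l^+$ be the group of all $T\in\mathcal T_l$ with positive diagonal entries, let $\mathcal P=\{TT^*: T\in\mathcal T_l^+\}\subset\mathcal H$ be the associated homogeneous cone, and let $\mathcal P^*=\{\theta\in\mathcal H:\operatorname{tr}(\theta Z)>0\text{ for all }Z\in\overline{\mathcal P}\setminus\{0\}\}$ be its open dual cone; every $\theta\in\mathcal P^*$ is $T^*T$ for a unique $T\in\mathcal T_l^+$, and $\theta^{-1}:=T^{-1}(T^{-1})^*\in\mathcal P$. Let $dZ=\prod_i dz_{ii}\prod_{j\prec i}dz_{ij}$ be Lebesgue measure on $\mathcal H$, where $dz_{ij}$ is the Lebesgue measure of the Euclidean space $\mathcal A_{ij}$ with $\|a\|^2=aa^*$. Put $$n_{i\cdot}=\sum_{\mu\prec i}n_{i\mu},\quad n_{\cdot i}=\sum_{i\prec\mu}n_{\mu i},\quad n_i=1+\tfrac12(n_{i\cdot}+n_{\cdot i}),\quad n_\cdot=\sum_{i\in I}n_i .$$ For $\chi=(\lambda_i)_{i\in I}\in\mathbb R^I$ and $X=TT^*\in\mathcal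 P$ with $T=(t_{ij})\in\mathcal T_l^+$ let $$\Delta_\chi(X)=\prod_{k\in I}\left(\frac{\prod_{j\preceq k}t_{jj}^2}{\prod_{j\prec k}t_{jj}^2}\right)^{\lambda_k}.$$ A Riesz measure $R_\chi$ is a positive Borel measure on $\mathcal H$, concentrated on $\overline{\mathcal P}$, with $$\int e^{-\operatorname{tr}(\theta Z)}\,R_\chi(dZ)=\Delta_\chi(\theta^{-1})\qquad\text{for all }\theta\in\mathcal P^* .$$ **Proposition 3.5.** Let $\chi=(\lambda_i)_{i\in I}\in\mathbb R^I$. A Riesz measure $R_\chi$ is absolutely continuous with respect to $dZ$ if and only if $\lambda_i>n_{i\cdot}/2$ for all $i\in I$. If $\lambda_i>n_{i\cdot}/2$ for all $i\in I$, then $R_\chi$ exists, is unique, and $$R_\chi(dZ)=\frac1{\Gamma_{\mathcal P}(\chi)}\,\Delta_{\chi+\ddot\chi}(Z)\,1_{\mathcal P}(Z)\,dZ,\qquad \ddot\chi=(-n_i)_{i\in I},\qquad \Gamma_{\mathcal P}(\chi)=\pi^{\frac{n_\cdot-|I|}2}\prod_{i\in I}\Gamma\!\left(\lambda_i-\tfrac{n_{i\cdot}}2\right).$$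 -/

import Mathlib

open MeasureTheory

/-- The "matrices" `(a i j)` with entries `a i j` in the spaces `A i j`. -/
abbrev VinMat {I : Type*} (A : I → I → Type*) : Type _ := ∀ i j, A i j

/-- The operations of a Vinberg algebra on entries: an identification of every diagonal space with
`ℝ`, bilinear products `A i j × A j k → A i k`, and linear maps `a ↦ a^*` from `A i j` to `A j i`. -/
structure VinbergData {I : Type*} (A : I → I → Type*)
    [∀ i j, NormedAddCommGroup (A i j)] [∀ i j, InnerProductSpace ℝ (A i j)] where
  scal : ∀ i, A i i ≃ₗ[ℝ] ℝ
  emul : ∀ i j k, A i j →ₗ[ℝ] A j k →ₗ[ℝ] A i k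
  eadj : ∀ i j, A i j →ₗ[ℝ] A j i

namespace VinbergData

variable {I : Type*} [Fintype I] [PartialOrder I] {A : I → I → Type*}
  [∀ i j, NormedAddCommGroup (A i j)] [∀ i j, InnerProductSpace ℝ (A i j)]

/-- Matrix product. -/
noncomputable def mul (V : VinbergData A) (X Y : VinMat A) : VinMat A :=
  fun i k => ∑ j, V.emul i j k (X i j) (Y j k)

/-- The involution `X ↦ X^*`. -/
def adj (V : VinbergData A) (X : VinMat A) : VinMat A := fun i j => V.eadj j i (X j i)

/-- The trace. -/
noncomputable def tr (V : VinbergData A) (X : VinMat A) : ℝ := ∑ i, V.scal i (X i i)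

open Classical in
/-- The unit matrix `e`. -/
noncomputable def one (V : VinbergData A) : VinMat A :=
  fun i j => if h : i = j then h ▸ (V.scal i).symm 1 else 0

/-- Lower triangular matrices `𝒯_l`: the entry `(i, j)` vanishes unless `j ≼ i`. -/
def lower (_V : VinbergData A) : Set (VinMat A) := {T | ∀ i j, ¬ j ≤ i → T i j = 0}

/-- Lower triangular matrices with positive diagonal, `𝒯_l^+`. -/
def lowerPos (V : VinbergData A) : Set (VinMat A) := {T | T ∈ V.lower ∧ ∀ i, 0 < V.scal i (T i i)}

/-- The space `ℋ` of Hermitian matrices. -/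
def herm (V : VinbergData A) : Submodule ℝ (VinMat A) where
  carrier := {X | V.adj X = X}
  add_mem' := by
    intro X Y hX hY
    funext i j
    have h1 := congrFun (congrFun hX i) j
    have h2 := congrFun (congrFun hY i) j
    simp only [adj] at h1 h2
    simp [adj, h1, h2]
  zero_mem' := by
    funext i j
    simp [adj]
  smul_mem' := by
    intro c X hX
    funext i j
    have h1 := congrFun (congrFun hX i) j
    simp only [adj] at h1
    simp [adj, h1]

end VinbergData

/-- A Vinberg algebra over the finite poset `I`. The Euclidean structure of each `A i j` is the one
of the algebra itself: `‖a‖ ^ 2 = a a^*`. -/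
structure VinbergAlgebra {I : Type*} [Fintype I] [PartialOrder I] (A : I → I → Type*)
    [∀ i j, NormedAddCommGroup (A i j)] [∀ i j, InnerProductSpace ℝ (A i j)]
    extends VinbergData A where
  nontrivial_of_lt : ∀ i j, j < i → Nontrivial (A i j)
  subsingleton_of_incomp : ∀ i j, ¬ i ≤ j → ¬ j ≤ i → Subsingleton (A i j)
  scal_eadj : ∀ i a, scal i (eadj i i a) = scal i a
  eadj_eadj : ∀ i j a, eadj j i (eadj i j a) = a
  norm_sq_eq : ∀ i j (a : A i j), ‖a‖ ^ 2 = scal i (emul i j i a (eadj i j a))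
  one_mul : ∀ X, toVinbergData.mul toVinbergData.one X = X
  mul_one : ∀ X, toVinbergData.mul X toVinbergData.one = X
  tr_pos : ∀ X, X ≠ 0 → 0 < toVinbergData.tr (toVinbergData.mul X (toVinbergData.adj X))
  adj_mul : ∀ X Y, toVinbergData.adj (toVinbergData.mul X Y) =
    toVinbergData.mul (toVinbergData.adj Y) (toVinbergData.adj X)
  tr_comm : ∀ X Y, toVinbergData.tr (toVinbergData.mul X Y) =
    toVinbergData.tr (toVinbergData.mul Y X)
  tr_assoc : ∀ X Y Z, toVinbergData.tr (toVinbergData.mul X (toVinbergData.mul Y Z)) =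
    toVinbergData.tr (toVinbergData.mul (toVinbergData.mul X Y) Z)
  lower_assoc : ∀ S ∈ toVinbergData.lower, ∀ T ∈ toVinbergData.lower, ∀ U ∈ toVinbergData.lower,
    toVinbergData.mul (toVinbergData.mul S T) U = toVinbergData.mul S (toVinbergData.mul T U)
  lower_adj_assoc : ∀ T ∈ toVinbergData.lower, ∀ U ∈ toVinbergData.lower,
    toVinbergData.mul T (toVinbergData.mul U (toVinbergData.adj U)) =
      toVinbergData.mul (toVinbergData.mul T U) (toVinbergData.adj U)

namespace VinbergAlgebra

variable {I : Type*} [Fintype I] [PartialOrder I] {A : I → I → Type*}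
  [∀ i j, NormedAddCommGroup (A i j)] [∀ i j, InnerProductSpace ℝ (A i j)]

/-- The homogeneous cone `𝒫 = {T T^* : T ∈ 𝒯_l^+}`, as a subset of `ℋ`. -/
def cone (V : VinbergAlgebra A) : Set V.herm :=
  {Z | ∃ T ∈ V.lowerPos, V.mul T (V.adj T) = Z}

/-- The (open) dual cone `𝒫^*`, with `ℋ` identified with its dual through `(X, Y) ↦ tr (X Y)`. -/
def dualCone (V : VinbergAlgebra A) : Set V.herm :=
  {θ | ∀ Z ∈ closure V.cone, Z ≠ 0 → 0 < V.tr (V.mul θ Z)}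

/-- The factor `T ∈ 𝒯_l^+` of `Z = T T^* ∈ 𝒫`. -/
noncomputable def factor (V : VinbergAlgebra A) (Z : VinMat A) : VinMat A :=
  Classical.epsilon fun T => T ∈ V.lowerPos ∧ V.mul T (V.adj T) = Z

/-- The factor `T ∈ 𝒯_l^+` of `θ = T^* T ∈ 𝒫^*`. -/
noncomputable def dualFactor (V : VinbergAlgebra A) (θ : VinMat A) : VinMat A :=
  Classical.epsilon fun T => T ∈ V.lowerPos ∧ V.mul (V.adj T) T = θ

/-- The inverse of `T` in the group `𝒯_l^+`. -/
noncomputable def lowerInv (V : VinbergAlgebra A) (T : VinMat A) : VinMat A :=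
  Classical.epsilon fun S => S ∈ V.lowerPos ∧ V.mul T S = V.one ∧ V.mul S T = V.one

/-- The inverse `θ⁻¹ = T⁻¹ (T⁻¹)^* ∈ 𝒫` of `θ = T^* T ∈ 𝒫^*`. -/
noncomputable def dualInv (V : VinbergAlgebra A) (θ : VinMat A) : VinMat A :=
  V.mul (V.lowerInv (V.dualFactor θ)) (V.adj (V.lowerInv (V.dualFactor θ)))

open Classical in
/-- Large principal minor `∏_{j ≼ k} t_{jj}^2` of `X = T T^*`. -/
noncomputable def largeMinor (V : VinbergAlgebra A) (k : I) (X : VinMat A) : ℝ :=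
  ∏ j with j ≤ k, V.scal j (V.factor X j j) ^ 2

open Classical in
/-- Strict principal minor `∏_{j ≺ k} t_{jj}^2` of `X = T T^*`. -/
noncomputable def strictMinor (V : VinbergAlgebra A) (k : I) (X : VinMat A) : ℝ :=
  ∏ j with j < k, V.scal j (V.factor X j j) ^ 2

/-- The generalized power `Δ_χ(X)`, `X ∈ 𝒫`, of the multiplier `χ = (λ_i)`. -/
noncomputable def genPower (V : VinbergAlgebra A) (χ : I → ℝ) (X : VinMat A) : ℝ :=
  ∏ k, (V.largeMinor k X / V.strictMinor k X) ^ χ k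

open Classical in
/-- `n_{i·} = ∑_{μ ≺ i} dim A_{iμ}`. -/
noncomputable def nRow (_V : VinbergAlgebra A) (i : I) : ℕ :=
  ∑ m with m < i, Module.finrank ℝ (A i m)

open Classical in
/-- `n_{·i} = ∑_{i ≺ μ} dim A_{μi}`. -/
noncomputable def nCol (_V : VinbergAlgebra A) (i : I) : ℕ :=
  ∑ m with i < m, Module.finrank ℝ (A m i)

/-- `n_i = 1 + (n_{i·} + n_{·i}) / 2`. -/
noncomputable def nVal (V : VinbergAlgebra A) (i : I) : ℝ :=
  1 + ((V.nRow i : ℝ) + (V.nCol i : ℝ)) / 2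

/-- `n_· = ∑ n_i`. -/
noncomputable def nTot (V : VinbergAlgebra A) : ℝ := ∑ i, V.nVal i

/-- `Γ_𝒫(χ) = π^((n_· - |I|)/2) ∏ Γ(λ_i - n_{i·}/2)`. -/
noncomputable def gammaCone (V : VinbergAlgebra A) (χ : I → ℝ) : ℝ :=
  Real.pi ^ ((V.nTot - (Fintype.card I : ℝ)) / 2) *
    ∏ i, Real.Gamma (χ i - (V.nRow i : ℝ) / 2)

/-- The coordinates `(z_{ij})_{j ≼ i}`, which determine a Hermitian matrix. -/
def lowerCoords (V : VinbergAlgebra A) (Z : V.herm) :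
    ∀ p : {p : I × I // p.2 ≤ p.1}, A p.1.1 p.1.2 :=
  fun p => (Z : VinMat A) p.1.1 p.1.2

variable [∀ i j, FiniteDimensional ℝ (A i j)] [∀ i j, MeasurableSpace (A i j)]
  [∀ i j, BorelSpace (A i j)]

open Classical in
/-- Lebesgue measure `dZ = ∏_i dz_{ii} ∏_{j ≺ i} dz_{ij}` on `ℋ`, where `dz_{ij}` is the Lebesgue
measure of the Euclidean space `A i j`. -/
noncomputable def lebesgue (V : VinbergAlgebra A) : Measure V.herm :=
  Measure.comap V.lowerCoords volume

/-- `ρ` is a Riesz measure `R_χ`: a positive measure on the closed cone `closure 𝒫` whose Laplace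
transform is `θ ↦ Δ_χ(θ⁻¹)` on `𝒫^*`. -/
def IsRiesz (V : VinbergAlgebra A) (χ : I → ℝ) (ρ : Measure V.herm) : Prop :=
  ρ (closure V.cone)ᶜ = 0 ∧
    ∀ θ ∈ V.dualCone, ∫⁻ Z, ENNReal.ofReal (Real.exp (-V.tr (V.mul θ Z))) ∂ρ =
      ENNReal.ofReal (V.genPower χ (V.dualInv θ))

end VinbergAlgebra

/-! ### Integrals of products, determinants of triangular maps, Laplace transforms -/

/-! The map `x ↦ x x^*` identifies the triangular group with the cone, and every computation is
carried out on the group. Axiom (vi) and the trace axioms give tr((q^*q)(x x^*)) = ‖qx‖², so the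
Laplace transform at θ = q^*q is a Gaussian integral over the group. Two triangular Jacobians enter:
∏ 2 x_ii^(1+n_{·i}) for `x ↦ x x^*` (`det_sqDeriv`) and ∏ q_ii^(1+n_{i·}) for left multiplication by
q (`det_lowMul`). What remains splits over the matrix entries into Gamma integrals on the diagonal
and Gaussians below it (`setLIntegral_posSet_prod`); this yields `isRiesz_withDensity`. That every θ
in the dual cone is some q^*q is proved variationally in `exists_dualSq_of_mem_dualCone`.

Uniqueness (`IsRiesz.unique`): the prescribed transform is finite near the unit e, so the weight
exp(-tr Z) produces finite measures with exponential moments, and analytic continuation recovers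
their characteristic functions.

Conversely, an absolutely continuous Riesz measure does not charge the boundary of the cone, hence
comes from a measure on the group. Uniqueness makes that measure relatively invariant under left
translations (`eq_smul_map_mul_left`); divided by its multiplier it is left invariant, hence a
multiple of Haar measure. Since the transform at e is finite and nonzero, the integral of ∏
x_ii^(2λ_i-1-n_{i·}) exp(-‖x‖²) converges, which forces every exponent above -1, that is λ_i >
n_{i·}/2. -/

open scoped ENNReal in
theorem lintegral_fin_prod_eq_prod {n : ℕ} {E : Fin n → Type*}
    {mE : ∀ i, MeasurableSpace (E i)} {μ : (i : Fin n) → Measure (E i)} [∀ i, SigmaFinite (μ i)]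
    (f : (i : Fin n) → E i → ℝ≥0∞) (hf : ∀ i, Measurable (f i)) :
    ∫⁻ x : (i : Fin n) → E i, ∏ i, f i (x i) ∂(Measure.pi μ) = ∏ i, ∫⁻ x, f i x ∂(μ i) := by
  induction n with
  | zero => simp
  | succ n n_ih =>
    calc
      _ = ∫⁻ x : E 0 × ((i : Fin n) → E (Fin.succ i)),
          f 0 x.1 * ∏ i : Fin n, f (Fin.succ i) (x.2 i)
          ∂((μ 0).prod (Measure.pi (fun i ↦ μ i.succ))) := by
        rw [← ((measurePreserving_piFinSuccAbove μ 0).symm).lintegral_comp_emb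
          (MeasurableEquiv.measurableEmbedding _)]
        simp_rw [MeasurableEquiv.piFinSuccAbove_symm_apply, Fin.insertNthEquiv,
          Fin.prod_univ_succ, Equiv.coe_fn_mk, Fin.insertNth_zero, Fin.cons_succ, Fin.cons_zero]
        rfl
      _ = (∫⁻ x, f 0 x ∂μ 0)
          * ∏ i : Fin n, ∫⁻ (x : E (Fin.succ i)), f (Fin.succ i) x ∂(μ i.succ) := by
        rw [← n_ih _ fun i => hf _]
        exact lintegral_prod_mul
          (g := fun y : (i : Fin n) → E i.succ => ∏ i : Fin n, f i.succ (y i))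
          (hf 0).aemeasurable
          (Finset.measurable_prod _ fun i _ =>
            (hf i.succ).comp (measurable_pi_apply i)).aemeasurable
      _ = ∏ i, ∫⁻ x, f i x ∂(μ i) := by rw [Fin.prod_univ_succ]

open scoped ENNReal in
/-- Tonelli's theorem for a product of functions of one variable each. -/
theorem lintegral_pi_prod_eq_prod {ι : Type*} [Fintype ι] {E : ι → Type*}
    (f : (i : ι) → E i → ℝ≥0∞) {mE : ∀ i, MeasurableSpace (E i)} {μ : (i : ι) → Measure (E i)}
    [∀ i, SigmaFinite (μ i)] (hf : ∀ i, Measurable (f i)) :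
    ∫⁻ x : (i : ι) → E i, ∏ i, f i (x i) ∂(Measure.pi μ) = ∏ i, ∫⁻ x, f i x ∂(μ i) := by
  let e := (Fintype.equivFin ι).symm
  rw [← (measurePreserving_piCongrLeft _ e).lintegral_comp_emb
    (MeasurableEquiv.measurableEmbedding _)]
  simp_rw [← e.prod_comp, MeasurableEquiv.coe_piCongrLeft, Equiv.piCongrLeft_apply_apply]
  exact lintegral_fin_prod_eq_prod _ fun i => hf _

/-- The determinant of an endomorphism of a product of vector spaces that is triangular for a rank
function `r` on the indices and acts on the diagonal blocks by scalars `c p`. -/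
theorem LinearMap.det_pi_of_triangular {ι α : Type*} [Fintype ι] [LinearOrder α] {E : ι → Type*}
    [∀ p, AddCommGroup (E p)] [∀ p, Module ℝ (E p)] [∀ p, FiniteDimensional ℝ (E p)]
    (L : (∀ p, E p) →ₗ[ℝ] (∀ p, E p)) (r : ι → α) (c : ι → ℝ)
    (h : ∀ p u, (∀ q, r q < r p → u q = 0) → L u p = c p • u p) :
    LinearMap.det L = ∏ p, c p ^ Module.finrank ℝ (E p) := by
  classical
  let b : ∀ p, Module.Basis (Fin (Module.finrank ℝ (E p))) ℝ (E p) :=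
    fun p => Module.finBasis ℝ (E p)
  let B := Pi.basis b
  -- A basis vector in block t vanishes on all blocks of rank below r s ≤ r t, so the hypothesis on
  -- L applies to it.
  have hM : ∀ s t : (Σ p, Fin (Module.finrank ℝ (E p))), r s.1 ≤ r t.1 →
      LinearMap.toMatrix B B L s t = if s = t then c s.1 else 0 := by
    rintro ⟨p, a⟩ ⟨q, b'⟩ hrs
    rw [LinearMap.toMatrix_apply, Pi.basis_repr, Pi.basis_apply]
    dsimp only at hrs ⊢
    rw [h p]
    · by_cases hpq : p = q
      · subst hpq
        simp [Finsupp.single_apply, eq_comm]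
      · simp [hpq]
    · intro q' hq'
      have : q' ≠ q := by rintro rfl; exact absurd hq' (not_lt.2 hrs)
      simp [this]
  -- Entries vanish when the row has smaller rank than the column, so the matrix is block triangular
  -- for the reversed order.
  have hT : (LinearMap.toMatrix B B L).BlockTriangular (fun s => OrderDual.toDual (r s.1)) := by
    intro s t hst
    have hst' : r s.1 < r t.1 := hst
    rw [hM s t hst'.le, if_neg]
    rintro rfl
    exact lt_irrefl _ hst'
  rw [← LinearMap.det_toMatrix B, hT.det]
  have hdiag : ∀ a, ((LinearMap.toMatrix B B L).toSquareBlock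
      (fun s => OrderDual.toDual (r s.1)) a).det =
      ∏ s : (Σ p, Fin (Module.finrank ℝ (E p))) with OrderDual.toDual (r s.1) = a, c s.1 := by
    intro a
    have : (LinearMap.toMatrix B B L).toSquareBlock (fun s => OrderDual.toDual (r s.1)) a =
        Matrix.diagonal fun s => c s.1.1 := by
      ext ⟨s, hs⟩ ⟨t, ht⟩
      have hs' : r s.1 = r t.1 := hs.trans ht.symm
      simp only [Matrix.toSquareBlock_def, Matrix.of_apply, Matrix.diagonal_apply, hM s t hs'.le,
        Subtype.mk.injEq]
    rw [this, Matrix.det_diagonal]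
    exact (Finset.prod_subtype (Finset.univ.filter fun s : (Σ p, Fin (Module.finrank ℝ (E p))) =>
      OrderDual.toDual (r s.1) = a) (fun s => by simp) fun s => c s.1).symm
  rw [Finset.prod_congr rfl fun a _ => hdiag a,
    Finset.prod_fiberwise_of_maps_to (fun s _ => Finset.mem_image_of_mem _ (Finset.mem_univ s)),
    Fintype.prod_sigma]
  simp

/-- Finite measures with the same Laplace transform along each line near the origin are equal. -/
theorem MeasureTheory.Measure.ext_of_laplace {E : Type*} [NormedAddCommGroup E] [NormedSpace ℝ E]
    [MeasurableSpace E] [BorelSpace E] [SecondCountableTopology E] [CompleteSpace E]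
    {μ ν : Measure E} [IsFiniteMeasure μ] [IsFiniteMeasure ν]
    (h : ∀ L : StrongDual ℝ E, ∃ ε : ℝ, 0 < ε ∧ ∀ t : ℝ, |t| < ε →
      ∫⁻ v, ENNReal.ofReal (Real.exp (t * L v)) ∂μ ≠ ⊤ ∧
      ∫⁻ v, ENNReal.ofReal (Real.exp (t * L v)) ∂μ =
        ∫⁻ v, ENNReal.ofReal (Real.exp (t * L v)) ∂ν) : μ = ν := by
  open ProbabilityTheory Filter Topology in
  refine Measure.ext_of_charFunDual (funext fun L => ?_)
  obtain ⟨ε, hε, hL⟩ := h L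
  have hmeas : ∀ t : ℝ, Measurable fun v => Real.exp (t * L v) := fun t => by fun_prop
  have hint : ∀ (κ : Measure E) (t : ℝ), ∫⁻ v, ENNReal.ofReal (Real.exp (t * L v)) ∂κ ≠ ⊤ →
      Integrable (fun v => Real.exp (t * L v)) κ := fun κ t hk =>
    (lintegral_ofReal_ne_top_iff_integrable (hmeas t).aestronglyMeasurable
      (Eventually.of_forall fun _ => (Real.exp_pos _).le)).1 hk
  have hball : IsOpen (Set.Ioo (-ε) ε) := isOpen_Ioo
  have hμ : Set.Ioo (-ε) ε ⊆ interior (integrableExpSet L μ) :=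
    interior_maximal (fun t ht => hint μ t (hL t (abs_lt.2 ht)).1) hball
  have hν : Set.Ioo (-ε) ε ⊆ interior (integrableExpSet L ν) :=
    interior_maximal (fun t ht => hint ν t
      ((hL t (abs_lt.2 ht)).2 ▸ (hL t (abs_lt.2 ht)).1)) hball
  have hmgf : ∀ t ∈ Set.Ioo (-ε) ε, mgf L μ t = mgf L ν t := by
    intro t ht
    simp only [mgf]
    rw [integral_eq_lintegral_of_nonneg_ae (Eventually.of_forall fun _ => (Real.exp_pos _).le)
      (hmeas t).aestronglyMeasurable, integral_eq_lintegral_of_nonneg_ae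
      (Eventually.of_forall fun _ => (Real.exp_pos _).le) (hmeas t).aestronglyMeasurable,
      (hL t (abs_lt.2 ht)).2]
  have hX : AnalyticOnNhd ℂ (complexMGF L μ) {z | z.re ∈ Set.Ioo (-ε) ε} :=
    analyticOnNhd_complexMGF.mono fun z hz => hμ hz
  have hY : AnalyticOnNhd ℂ (complexMGF L ν) {z | z.re ∈ Set.Ioo (-ε) ε} :=
    analyticOnNhd_complexMGF.mono fun z hz => hν hz
  have h0 : (0 : ℝ) ∈ Set.Ioo (-ε) ε := ⟨by linarith, hε⟩
  -- Identity theorem on a vertical strip: the two functions are analytic there and agree at real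
  -- points accumulating at 0. The value at the point i is the characteristic function along L.
  have key : Set.EqOn (complexMGF L μ) (complexMGF L ν) {z | z.re ∈ Set.Ioo (-ε) ε} := by
    refine AnalyticOnNhd.eqOn_of_preconnected_of_frequently_eq hX hY
      ((convex_Ioo _ _).linear_preimage Complex.reLm).isPreconnected
      (z₀ := ((0 : ℝ) : ℂ)) (by simpa using hε) ?_
    have h_real : ∃ᶠ (x : ℝ) in 𝓝[≠] 0, complexMGF L μ x = complexMGF L ν x := by
      refine Eventually.frequently ?_
      filter_upwards [mem_nhdsWithin_of_mem_nhds (hball.mem_nhds h0)] with t ht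
      rw [complexMGF_ofReal, complexMGF_ofReal, hmgf t ht]
    rw [frequently_iff_seq_forall] at h_real ⊢
    obtain ⟨xs, hx_tendsto, hx_eq⟩ := h_real
    refine ⟨fun n ↦ xs n, ?_, fun n ↦ hx_eq n⟩
    rw [tendsto_nhdsWithin_iff] at hx_tendsto ⊢
    exact ⟨tendsto_ofReal_iff.2 hx_tendsto.1, by simpa using hx_tendsto.2⟩
  have hI := @key Complex.I (by simpa using hε)
  simp only [complexMGF] at hI
  simp only [charFunDual_apply, mul_comm _ Complex.I]
  exact hI

/-- `∫_0^∞ t^a e^{-t²} dt` is finite only if `a > -1`. -/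
theorem neg_one_lt_of_lintegral_rpow_mul_exp_ne_top {a : ℝ}
    (h : ∫⁻ t in Set.Ioi (0 : ℝ), ENNReal.ofReal (t ^ a * Real.exp (-t ^ 2)) ≠ ⊤) : -1 < a := by
  rw [← intervalIntegral.integrableOn_Ioo_rpow_iff (zero_lt_one)]
  have h1 : IntegrableOn (fun t : ℝ => t ^ a * Real.exp (-t ^ 2)) (Set.Ioi 0) := by
    refine (lintegral_ofReal_ne_top_iff_integrable (by fun_prop) ?_).1 h
    filter_upwards [ae_restrict_mem measurableSet_Ioi] with t ht
    exact mul_nonneg (Real.rpow_nonneg (le_of_lt ht) _) (Real.exp_pos _).le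
  have h2 : IntegrableOn (fun t : ℝ => t ^ a * Real.exp (-t ^ 2)) (Set.Ioo 0 1) :=
    h1.mono_set Set.Ioo_subset_Ioi_self
  refine (h2.const_mul (Real.exp 1)).mono' (by fun_prop) ?_
  filter_upwards [ae_restrict_mem measurableSet_Ioo] with t ht
  rw [Real.norm_of_nonneg (Real.rpow_nonneg ht.1.le _)]
  -- On (0,1) the factor exp(-t²) is at least exp(-1), so it does not affect integrability at 0.
  have : 1 ≤ Real.exp 1 * Real.exp (-t ^ 2) := by
    rw [← Real.exp_add]
    apply Real.one_le_exp
    nlinarith [ht.1, ht.2]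
  nlinarith [Real.rpow_nonneg ht.1.le a]

theorem lintegral_rpow_mul_exp_neg_sq {a : ℝ} (ha : -1 < a) :
    ∫⁻ t in Set.Ioi (0 : ℝ), ENNReal.ofReal (t ^ a * Real.exp (-t ^ 2)) =
      ENNReal.ofReal (1 / 2 * Real.Gamma ((a + 1) / 2)) := by
  have h := integral_rpow_mul_exp_neg_rpow (p := 2) (q := a) two_pos ha
  have hi := integrableOn_rpow_mul_exp_neg_rpow (p := 2) ha two_pos
  simp only [Real.rpow_two] at h hi
  rw [← h, ofReal_integral_eq_lintegral_ofReal hi]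
  filter_upwards [ae_restrict_mem measurableSet_Ioi] with t ht
  exact mul_nonneg (Real.rpow_nonneg (le_of_lt ht) _) (Real.exp_pos _).le

theorem lintegral_exp_neg_norm_sq (W : Type*) [NormedAddCommGroup W] [InnerProductSpace ℝ W]
    [FiniteDimensional ℝ W] [MeasurableSpace W] [BorelSpace W] :
    ∫⁻ v : W, ENNReal.ofReal (Real.exp (-‖v‖ ^ 2)) =
      ENNReal.ofReal (Real.pi ^ ((Module.finrank ℝ W : ℝ) / 2)) := by
  have h := GaussianFourier.integral_rexp_neg_mul_sq_norm (V := W) (b := 1) one_pos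
  simp only [neg_mul, one_mul, div_one] at h
  rw [← h, ofReal_integral_eq_lintegral_ofReal]
  · by_contra hc
    rw [integral_undef hc] at h
    exact absurd h (Real.rpow_pos_of_pos Real.pi_pos _).ne
  · exact Filter.Eventually.of_forall fun _ => (Real.exp_pos _).le

/-! ### Lower triangular matrices -/

/-- The space `∏_{j ≼ i} A i j` of the entries of a lower triangular matrix. -/
abbrev LowSp {I : Type*} [PartialOrder I] (A : I → I → Type*) : Type _ :=
  ∀ p : {p : I × I // p.2 ≤ p.1}, A p.1.1 p.1.2

/-! ### Products over comparable pairs, grouped by rows or by columns -/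

section Reindex

open Classical in
theorem prod_lower_eq_prod_row {I M : Type*} [Fintype I] [PartialOrder I] [CommMonoid M]
    (F : I → I → M) : ∏ p : {p : I × I // p.2 ≤ p.1}, F p.1.1 p.1.2 =
      ∏ i, (F i i * ∏ j with j < i, F i j) := by
  rw [← Finset.prod_subtype (Finset.univ.filter fun p : I × I => p.2 ≤ p.1) (by simp)
    fun p => F p.1 p.2, Finset.prod_filter, ← Finset.univ_product_univ, Finset.prod_product]
  refine Finset.prod_congr rfl fun i _ => ?_
  rw [← Finset.prod_filter, ← Finset.prod_insert (s := Finset.univ.filter (· < i)) (by simp)]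
  congr 1
  ext j
  simp [le_iff_eq_or_lt]

open Classical in
theorem prod_lower_eq_prod_col {I M : Type*} [Fintype I] [PartialOrder I] [CommMonoid M]
    (F : I → I → M) : ∏ p : {p : I × I // p.2 ≤ p.1}, F p.1.1 p.1.2 =
      ∏ i, (F i i * ∏ m with i < m, F m i) := by
  rw [← Finset.prod_subtype (Finset.univ.filter fun p : I × I => p.2 ≤ p.1) (by simp)
    fun p => F p.1 p.2, Finset.prod_filter, ← Finset.univ_product_univ, Finset.prod_product_right]
  refine Finset.prod_congr rfl fun i _ => ?_
  rw [← Finset.prod_filter,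
    ← Finset.prod_insert (s := Finset.univ.filter (i < ·)) (f := fun m => F m i) (by simp)]
  congr 1
  ext j
  simp [le_iff_eq_or_lt, eq_comm]

/-- A linear extension of the partial order supplies the linearly ordered ranks needed to compute
triangular determinants. -/
theorem toLinearExtension_lt {I : Type*} [PartialOrder I] {i j : I} (h : i < j) :
    toLinearExtension i < toLinearExtension j :=
  lt_of_le_of_ne (toLinearExtension.monotone h.le) fun he => h.ne he

end Reindex

namespace VinbergAlgebra

section Entries

variable {I : Type*} [PartialOrder I] {A : I → I → Type*}
  [∀ i j, NormedAddCommGroup (A i j)] [∀ i j, InnerProductSpace ℝ (A i j)]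

open Classical in
/-- The lower triangular matrix with the given entries. -/
noncomputable def lowExt : LowSp A →ₗ[ℝ] VinMat A where
  toFun x i j := if h : j ≤ i then x ⟨(i, j), h⟩ else 0
  map_add' x y := by
    ext i j
    by_cases h : j ≤ i <;> simp [h]
  map_smul' c x := by
    ext i j
    by_cases h : j ≤ i <;> simp [h]

/-- The lower triangular entries of a matrix. -/
def lowRes : VinMat A →ₗ[ℝ] LowSp A where
  toFun X p := X p.1.1 p.1.2
  map_add' _ _ := rfl
  map_smul' _ _ := rfl

theorem lowExt_of_le (x : LowSp A) {i j : I} (h : j ≤ i) : lowExt x i j = x ⟨(i, j), h⟩ :=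
  dif_pos h

theorem lowExt_of_not_le (x : LowSp A) {i j : I} (h : ¬ j ≤ i) : lowExt x i j = 0 :=
  dif_neg h

theorem lowRes_apply (X : VinMat A) (p : {p : I × I // p.2 ≤ p.1}) :
    lowRes X p = X p.1.1 p.1.2 := rfl

@[simp] theorem lowRes_lowExt (x : LowSp A) : lowRes (lowExt x) = x := by
  ext p
  exact lowExt_of_le x p.2

theorem lowExt_injective : Function.Injective (lowExt : LowSp A →ₗ[ℝ] VinMat A) :=
  Function.LeftInverse.injective lowRes_lowExt

end Entries

/-! ### Consequences of the axioms for entries, trace and triangular products -/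

open VinbergData

variable {I : Type*} [Fintype I] [PartialOrder I] {A : I → I → Type*}
  [∀ i j, NormedAddCommGroup (A i j)] [∀ i j, InnerProductSpace ℝ (A i j)]
  (V : VinbergAlgebra A)

theorem one_apply_self (i : I) : V.one i i = (V.scal i).symm 1 := by simp [VinbergData.one]

theorem one_apply_ne {i j : I} (h : i ≠ j) : V.one i j = 0 := by simp [VinbergData.one, h]

theorem diag_eq_smul (i : I) (a : A i i) : a = V.scal i a • (V.scal i).symm 1 := by
  apply (V.scal i).injective
  simp

/-- The unit axiom tested on a matrix with a single nonzero entry shows that the unit of `A i i`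
acts as the identity; every diagonal element is a multiple of that unit. -/
theorem emul_diag_left (i j : I) (a : A i i) (x : A i j) : V.emul i i j a x = V.scal i a • x := by
  classical
  have h := congrFun (congrFun (V.one_mul (Pi.single i (Pi.single j x))) i) j
  simp only [VinbergData.mul, Pi.single_eq_same] at h
  rw [Finset.sum_eq_single i (fun k _ hk => by rw [one_apply_ne V hk.symm]; simp) (by simp),
    one_apply_self] at h
  rw [V.diag_eq_smul i a]
  simpa using congrArg (V.scal i a • ·) h

theorem emul_diag_right (i j : I) (x : A i j) (a : A j j) :
    V.emul i j j x a = V.scal j a • x := by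
  classical
  have h := congrFun (congrFun (V.mul_one (Pi.single i (Pi.single j x))) i) j
  simp only [VinbergData.mul, Pi.single_eq_same] at h
  rw [Finset.sum_eq_single j (fun k _ hk => by rw [one_apply_ne V hk]; simp) (by simp),
    one_apply_self] at h
  rw [V.diag_eq_smul j a]
  simpa using congrArg (V.scal j a • ·) h

theorem eadj_diag (i : I) (a : A i i) : V.eadj i i a = a :=
  (V.scal i).injective (V.scal_eadj i a)

theorem norm_diag (i : I) (a : A i i) : ‖a‖ = |V.scal i a| := by
  have h := V.norm_sq_eq i i a
  rw [eadj_diag, emul_diag_left, map_smul, smul_eq_mul, ← sq] at h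
  rw [← abs_norm]
  exact (sq_eq_sq_iff_abs_eq_abs _ _).1 h

theorem finrank_diag (V : VinbergAlgebra A) (i : I) : Module.finrank ℝ (A i i) = 1 := by
  rw [(V.scal i).finrank_eq, Module.finrank_self]

theorem tr_mul_adj (X : VinMat A) : V.tr (V.mul X (V.adj X)) = ∑ i, ∑ j, ‖X i j‖ ^ 2 := by
  simp only [VinbergData.tr, VinbergData.mul, VinbergData.adj, map_sum, V.norm_sq_eq]

/-- The multiplication as a bilinear map. -/
noncomputable def mulBilin : VinMat A →ₗ[ℝ] VinMat A →ₗ[ℝ] VinMat A :=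
  LinearMap.mk₂ ℝ V.mul
    (fun X Y Z => by ext; simp [VinbergData.mul, Finset.sum_add_distrib])
    (fun c X Y => by ext; simp [VinbergData.mul, Finset.smul_sum])
    (fun X Y Z => by ext; simp [VinbergData.mul, Finset.sum_add_distrib])
    (fun c X Y => by ext; simp [VinbergData.mul, Finset.smul_sum])

@[simp] theorem mulBilin_apply (X Y : VinMat A) : V.mulBilin X Y = V.mul X Y := rfl

/-- The involution as a linear map. -/
def adjLin : VinMat A →ₗ[ℝ] VinMat A where
  toFun := V.adj
  map_add' X Y := by ext; simp [VinbergData.adj]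
  map_smul' c X := by ext; simp [VinbergData.adj]

@[simp] theorem adjLin_apply (X : VinMat A) : V.adjLin X = V.adj X := rfl

/-- The trace as a linear map. -/
noncomputable def trLin : VinMat A →ₗ[ℝ] ℝ where
  toFun := V.tr
  map_add' X Y := by simp [VinbergData.tr, Finset.sum_add_distrib]
  map_smul' c X := by simp [VinbergData.tr, Finset.mul_sum]

@[simp] theorem trLin_apply (X : VinMat A) : V.trLin X = V.tr X := rfl

theorem adj_adj (X : VinMat A) : V.adj (V.adj X) = X := by
  ext i j
  simp [VinbergData.adj, V.eadj_eadj]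

theorem tr_adj (X : VinMat A) : V.tr (V.adj X) = V.tr X := by
  simp [VinbergData.tr, VinbergData.adj, V.scal_eadj]

theorem mem_herm {X : VinMat A} : X ∈ V.herm ↔ V.adj X = X := Iff.rfl

theorem mul_adj_mem_herm (X : VinMat A) : V.mul X (V.adj X) ∈ V.herm := by
  rw [mem_herm, V.adj_mul, adj_adj]

theorem adj_mul_mem_herm (X : VinMat A) : V.mul (V.adj X) X ∈ V.herm := by
  rw [mem_herm, V.adj_mul, adj_adj]

theorem one_mem_lower : V.one ∈ V.lower := fun _ _ h => V.one_apply_ne fun e => h e.ge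

theorem mul_mem_lower {X Y : VinMat A} (hX : X ∈ V.lower) (hY : Y ∈ V.lower) :
    V.mul X Y ∈ V.lower := by
  intro i k hk
  refine Finset.sum_eq_zero fun j _ => ?_
  by_cases hj : j ≤ i
  · rw [hY j k fun h => hk (h.trans hj), map_zero]
  · rw [hX i j hj, map_zero, LinearMap.zero_apply]

theorem scal_mul_diag {X Y : VinMat A} (hX : X ∈ V.lower) (hY : Y ∈ V.lower) (i : I) :
    V.scal i (V.mul X Y i i) = V.scal i (X i i) * V.scal i (Y i i) := by
  rw [VinbergData.mul, Finset.sum_eq_single i, emul_diag_left, map_smul, smul_eq_mul]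
  · intro j _ hj
    by_cases h : j ≤ i
    · rw [hY j i fun h' => hj (le_antisymm h h'), map_zero]
    · rw [hX i j h, map_zero, LinearMap.zero_apply]
  · simp

/-- The full algebra is not associative. Under the trace Q^* can be detached, axiom (vi) regroups
Q(WW^*) as (QW)W^*, and cyclicity moves Q^* next to W^*. This turns the Laplace kernel at q^*q into
a Gaussian in qw. -/
theorem tr_adj_mul_mul_mul_adj {Q W : VinMat A} (hQ : Q ∈ V.lower) (hW : W ∈ V.lower) :
    V.tr (V.mul (V.mul (V.adj Q) Q) (V.mul W (V.adj W))) =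
      V.tr (V.mul (V.mul Q W) (V.adj (V.mul Q W))) := by
  rw [← V.tr_assoc, V.lower_adj_assoc Q hQ W hW, V.tr_comm, ← V.tr_assoc, ← V.adj_mul]

theorem lowExt_mem_lower (x : LowSp A) : lowExt x ∈ V.lower := fun _ _ h => lowExt_of_not_le x h

theorem lowExt_lowRes {X : VinMat A} (hX : X ∈ V.lower) : lowExt (lowRes X) = X := by
  ext i j
  by_cases h : j ≤ i
  · exact lowExt_of_le _ h
  · rw [lowExt_of_not_le _ h, hX i j h]

/-- The diagonal entries as real numbers. -/
def diagEntry (i : I) : LowSp A →ₗ[ℝ] ℝ :=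
  (V.scal i).toLinearMap ∘ₗ LinearMap.proj (⟨(i, i), le_rfl⟩ : {p : I × I // p.2 ≤ p.1})

theorem diagEntry_apply (i : I) (x : LowSp A) :
    V.diagEntry i x = V.scal i (x ⟨(i, i), le_rfl⟩) := rfl

theorem scal_lowExt (i : I) (x : LowSp A) : V.scal i (lowExt x i i) = V.diagEntry i x := by
  rw [lowExt_of_le x le_rfl, diagEntry_apply]

/-- Multiplication of lower triangular matrices. -/
noncomputable def lowMul : LowSp A →ₗ[ℝ] LowSp A →ₗ[ℝ] LowSp A :=
  (V.mulBilin.compl₁₂ lowExt lowExt).compr₂ lowRes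

theorem lowMul_apply (x y : LowSp A) :
    V.lowMul x y = lowRes (V.mul (lowExt x) (lowExt y)) := rfl

theorem lowExt_lowMul (x y : LowSp A) :
    lowExt (V.lowMul x y) = V.mul (lowExt x) (lowExt y) :=
  V.lowExt_lowRes (V.mul_mem_lower (V.lowExt_mem_lower x) (V.lowExt_mem_lower y))

theorem diagEntry_lowMul (i : I) (x y : LowSp A) :
    V.diagEntry i (V.lowMul x y) = V.diagEntry i x * V.diagEntry i y := by
  rw [← scal_lowExt, lowExt_lowMul, scal_mul_diag V (V.lowExt_mem_lower x) (V.lowExt_mem_lower y),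
    scal_lowExt, scal_lowExt]

/-- The unit among lower triangular matrices. -/
noncomputable def lowOne : LowSp A := lowRes V.one

theorem lowExt_lowOne : lowExt V.lowOne = V.one := V.lowExt_lowRes V.one_mem_lower

theorem diagEntry_lowOne (i : I) : V.diagEntry i V.lowOne = 1 := by
  rw [← scal_lowExt, lowExt_lowOne, one_apply_self, LinearEquiv.apply_symm_apply]

theorem lowMul_assoc (x y z : LowSp A) :
    V.lowMul (V.lowMul x y) z = V.lowMul x (V.lowMul y z) := by
  apply lowExt_injective
  simp only [lowExt_lowMul]
  exact V.lower_assoc _ (V.lowExt_mem_lower x) _ (V.lowExt_mem_lower y) _ (V.lowExt_mem_lower z)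

theorem lowMul_lowOne (x : LowSp A) : V.lowMul x V.lowOne = x := by
  apply lowExt_injective
  rw [lowExt_lowMul, lowExt_lowOne, V.mul_one]

theorem lowOne_lowMul (x : LowSp A) : V.lowMul V.lowOne x = x := by
  apply lowExt_injective
  rw [lowExt_lowMul, lowExt_lowOne, V.one_mul]

/-- The sum of the squares of the norms of the entries. -/
noncomputable def sqNorm (x : LowSp A) : ℝ := V.tr (V.mul (lowExt x) (V.adj (lowExt x)))

open Classical in
theorem sqNorm_eq (x : LowSp A) : V.sqNorm x = ∑ p, ‖x p‖ ^ 2 := by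
  rw [sqNorm, tr_mul_adj, ← Finset.sum_product', Finset.univ_product_univ,
    ← Fintype.sum_subtype_add_sum_subtype (fun p : I × I => p.2 ≤ p.1)]
  have h2 : ∑ p : {p : I × I // ¬ p.2 ≤ p.1}, ‖lowExt x p.1.1 p.1.2‖ ^ 2 = 0 :=
    Finset.sum_eq_zero fun p _ => by rw [lowExt_of_not_le x p.2]; simp
  rw [h2, add_zero]
  exact Finset.sum_congr rfl fun p _ => by rw [lowExt_of_le x p.2]

/-- `x ↦ x x^*` as a map from lower triangular matrices to Hermitian ones. -/
noncomputable def hermSq (x : LowSp A) : V.herm :=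
  ⟨V.mul (lowExt x) (V.adj (lowExt x)), V.mul_adj_mem_herm _⟩

/-- The Hermitian matrix `x^* x`. -/
noncomputable def dualSq (x : LowSp A) : V.herm :=
  ⟨V.mul (V.adj (lowExt x)) (lowExt x), V.adj_mul_mem_herm _⟩

theorem coe_hermSq (x : LowSp A) :
    (V.hermSq x : VinMat A) = V.mul (lowExt x) (V.adj (lowExt x)) := rfl

theorem coe_dualSq (x : LowSp A) :
    (V.dualSq x : VinMat A) = V.mul (V.adj (lowExt x)) (lowExt x) := rfl

theorem tr_dualSq_mul_hermSq (q w : LowSp A) :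
    V.tr (V.mul (V.dualSq q) (V.hermSq w)) = V.sqNorm (V.lowMul q w) := by
  rw [sqNorm, lowExt_lowMul]
  exact V.tr_adj_mul_mul_mul_adj (V.lowExt_mem_lower q) (V.lowExt_mem_lower w)

theorem dualSq_lowOne : (V.dualSq V.lowOne : VinMat A) = V.one := by
  rw [coe_dualSq, lowExt_lowOne, V.mul_one]
  ext i j
  by_cases h : i = j
  · subst h
    exact V.eadj_diag _ _
  · simp [VinbergData.adj, V.one_apply_ne h, V.one_apply_ne (Ne.symm h)]

/-- The polarization of `x ↦ x x^*`, in lower triangular coordinates. -/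
noncomputable def sqBilin : LowSp A →ₗ[ℝ] LowSp A →ₗ[ℝ] LowSp A :=
  (V.mulBilin.compl₁₂ lowExt (V.adjLin ∘ₗ lowExt)).compr₂ lowRes

theorem sqBilin_apply (x y : LowSp A) :
    V.sqBilin x y = lowRes (V.mul (lowExt x) (V.adj (lowExt y))) := rfl

/-- The derivative of `x ↦ x x^*` at `x`, in lower triangular coordinates. -/
noncomputable def sqDeriv (x : LowSp A) : LowSp A →ₗ[ℝ] LowSp A :=
  V.sqBilin x + V.sqBilin.flip x

theorem sqDeriv_apply (x u : LowSp A) : V.sqDeriv x u = V.sqBilin x u + V.sqBilin u x := rfl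

/-! ### Jacobians of left multiplication and of `x ↦ x x^*` -/

section Det

variable [∀ i j, FiniteDimensional ℝ (A i j)]

-- Rank the entries by row. Row i of xu is x_ii times row i of u plus terms from rows k < i, so all
-- of row i, of total dimension 1 + n_{i·}, carries the scalar x_ii.
open Classical in
theorem det_lowMul (x : LowSp A) :
    LinearMap.det (V.lowMul x) = ∏ i, V.diagEntry i x ^ (1 + V.nRow i) := by
  rw [LinearMap.det_pi_of_triangular (V.lowMul x) (fun p => toLinearExtension p.1.1)
    (fun p => V.diagEntry p.1.1 x),
    prod_lower_eq_prod_row fun i j => V.diagEntry i x ^ Module.finrank ℝ (A i j)]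
  · simp_rw [Finset.prod_pow_eq_pow_sum, V.finrank_diag, ← pow_add]
    rfl
  · rintro ⟨⟨i, j⟩, hij⟩ u hu
    dsimp only at hij hu ⊢
    rw [lowMul_apply, lowRes_apply]
    dsimp only [VinbergData.mul]
    rw [Finset.sum_eq_single i, emul_diag_left, scal_lowExt, lowExt_of_le u hij]
    · intro k _ hk
      by_cases hki : k ≤ i
      · by_cases hjk : j ≤ k
        · rw [lowExt_of_le u hjk,
            hu ⟨(k, j), hjk⟩ (toLinearExtension_lt (lt_of_le_of_ne hki hk)), map_zero]
        · rw [lowExt_of_not_le u hjk, map_zero]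
      · rw [lowExt_of_not_le x hki, map_zero, LinearMap.zero_apply]
    · simp

-- Rank the entries by column, then by row. In entry (i, j) of x u^* + u x^* only the k = j terms
-- avoid earlier columns: they are u_jj x_ij and x_jj u_ij. For j < i the first involves the earlier
-- entry u_jj; for i = j the two coincide, whence the factor 2. Column j has total dimension 1 +
-- n_{·j}.
open Classical in
theorem det_sqDeriv (x : LowSp A) :
    LinearMap.det (V.sqDeriv x) = ∏ i, 2 * V.diagEntry i x ^ (1 + V.nCol i) := by
  rw [LinearMap.det_pi_of_triangular (V.sqDeriv x)
    (fun p => toLex (toLinearExtension p.1.2, toLinearExtension p.1.1))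
    (fun p => (if p.1.1 = p.1.2 then 2 else 1) * V.diagEntry p.1.2 x),
    prod_lower_eq_prod_col fun i j =>
      ((if i = j then 2 else 1) * V.diagEntry j x) ^ Module.finrank ℝ (A i j)]
  · refine Finset.prod_congr rfl fun i _ => ?_
    rw [if_pos rfl, V.finrank_diag, pow_one, pow_add, pow_one, mul_assoc]
    congr 2
    rw [nCol, ← Finset.prod_pow_eq_pow_sum]
    refine Finset.prod_congr rfl fun m hm => ?_
    rw [if_neg (Finset.mem_filter.1 hm).2.ne', _root_.one_mul]
  · rintro ⟨⟨i, j⟩, hij⟩ u hu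
    dsimp only at hij hu ⊢
    have hcol : ∀ k l (hkl : k ≤ l), k < j → u ⟨(l, k), hkl⟩ = 0 := fun k l hkl hk =>
      hu _ (Prod.Lex.toLex_lt_toLex.2 (Or.inl (toLinearExtension_lt hk)))
    have hdiag : j < i → u ⟨(j, j), le_rfl⟩ = 0 := fun h =>
      hu _ (Prod.Lex.toLex_lt_toLex.2 (Or.inr ⟨rfl, toLinearExtension_lt h⟩))
    rw [sqDeriv_apply, Pi.add_apply, sqBilin_apply, sqBilin_apply, lowRes_apply, lowRes_apply]
    dsimp only [VinbergData.mul, VinbergData.adj]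
    rw [Finset.sum_eq_single j, Finset.sum_eq_single j, eadj_diag, eadj_diag, emul_diag_right,
      emul_diag_right, scal_lowExt, scal_lowExt, lowExt_of_le _ hij, lowExt_of_le _ hij]
    · by_cases h : i = j
      · subst h
        rw [if_pos rfl, V.diagEntry_apply i u]
        apply (V.scal i).injective
        simp [diagEntry_apply]
        ring
      · rw [if_neg h, V.diagEntry_apply j u, hdiag (lt_of_le_of_ne hij (Ne.symm h))]
        simp
    · intro k _ hk
      by_cases hkj : k ≤ j
      · rw [lowExt_of_le u (hkj.trans hij), hcol _ _ _ (lt_of_le_of_ne hkj hk), map_zero,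
          LinearMap.zero_apply]
      · rw [lowExt_of_not_le x hkj, map_zero, map_zero]
    · simp
    · intro k _ hk
      by_cases hkj : k ≤ j
      · rw [lowExt_of_le u hkj, hcol _ _ _ (lt_of_le_of_ne hkj hk), map_zero, map_zero]
      · rw [lowExt_of_not_le u hkj, map_zero, map_zero]
    · simp

end Det

/-! ### Triangular coordinates on the Hermitian matrices -/

/-- The lower triangular coordinates of Hermitian matrices, as a linear map. -/
def coordsLin : V.herm →ₗ[ℝ] LowSp A := lowRes ∘ₗ V.herm.subtype

theorem coordsLin_injective : Function.Injective V.coordsLin := by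
  rw [← LinearMap.ker_eq_bot, LinearMap.ker_eq_bot']
  intro Z hZ
  have hlow : ∀ i j, j ≤ i → (Z : VinMat A) i j = 0 := fun i j h => congrFun hZ ⟨(i, j), h⟩
  ext i j
  by_cases h : j ≤ i
  · exact hlow i j h
  · by_cases h' : i ≤ j
    · have := congrFun (congrFun (V.mem_herm.1 Z.2) i) j
      rw [← this]
      simp [VinbergData.adj, hlow j i h']
    · have := V.subsingleton_of_incomp i j h' h
      exact Subsingleton.elim _ _

open Classical in
theorem coordsLin_surjective : Function.Surjective V.coordsLin := by
  intro x
  refine ⟨⟨fun i j => if h : j ≤ i then x ⟨(i, j), h⟩ else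
    if h' : i ≤ j then V.eadj j i (x ⟨(j, i), h'⟩) else 0, ?_⟩, ?_⟩
  · rw [mem_herm]
    ext i j
    simp only [VinbergData.adj]
    by_cases h : j ≤ i
    · by_cases h' : i ≤ j
      · obtain rfl := le_antisymm h h'
        simp [eadj_diag]
      · simp [h, h', V.eadj_eadj]
    · by_cases h' : i ≤ j <;> simp [h, h']
  · ext p
    exact dif_pos p.2

/-- A Hermitian matrix is determined by its lower triangular coordinates. -/
noncomputable def coordsEquiv : V.herm ≃ₗ[ℝ] LowSp A :=
  LinearEquiv.ofBijective V.coordsLin ⟨V.coordsLin_injective, V.coordsLin_surjective⟩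

theorem lowerCoords_hermSq (x : LowSp A) : V.lowerCoords (V.hermSq x) = V.sqBilin x x := rfl

end VinbergAlgebra

namespace VinbergAlgebra

open VinbergData

variable {I : Type*} [Fintype I] [PartialOrder I] {A : I → I → Type*}
  [∀ i j, NormedAddCommGroup (A i j)] [∀ i j, InnerProductSpace ℝ (A i j)]
  (V : VinbergAlgebra A)

/-! ### The group of lower triangular matrices with positive diagonal -/

/-- The entries of the matrices in `𝒯_l^+`. -/
def posSet : Set (LowSp A) := {x | ∀ i, 0 < V.diagEntry i x}

theorem lowExt_mem_lowerPos {x : LowSp A} (hx : x ∈ V.posSet) : lowExt x ∈ V.lowerPos :=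
  ⟨V.lowExt_mem_lower x, fun i => by rw [scal_lowExt]; exact hx i⟩

theorem exists_lowExt_of_mem_lowerPos {T : VinMat A} (hT : T ∈ V.lowerPos) :
    ∃ x ∈ V.posSet, lowExt x = T := by
  refine ⟨lowRes T, fun i => ?_, V.lowExt_lowRes hT.1⟩
  rw [← scal_lowExt, V.lowExt_lowRes hT.1]
  exact hT.2 i

theorem lowMul_mem_posSet {x y : LowSp A} (hx : x ∈ V.posSet) (hy : y ∈ V.posSet) :
    V.lowMul x y ∈ V.posSet := fun i => by
  rw [diagEntry_lowMul]
  exact mul_pos (hx i) (hy i)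

theorem lowOne_mem_posSet : V.lowOne ∈ V.posSet := fun i => by
  rw [diagEntry_lowOne]
  exact one_pos

-- Cholesky recursion on columns, upwards in the order: (x x^*)_ij is x_jj x_ij plus terms from
-- columns k < j. The diagonal entry i = j fixes x_jj because it is positive, and then the whole
-- column is determined.
open Classical in
theorem hermSq_injOn : Set.InjOn V.hermSq V.posSet := by
  intro x hx y hy hxy
  have hz : ∀ i j, V.mul (lowExt x) (V.adj (lowExt x)) i j =
      V.mul (lowExt y) (V.adj (lowExt y)) i j := fun i j =>
    congrFun (congrFun (congrArg Subtype.val hxy) i) j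
  suffices h : ∀ j i, lowExt x i j = lowExt y i j from
    lowExt_injective (funext fun i => funext fun j => h j i)
  intro j
  induction j using WellFoundedLT.induction with
  | ind j ih =>
  have hmul : ∀ i, V.diagEntry j x • lowExt x i j = V.diagEntry j y • lowExt y i j := by
    intro i
    have h := hz i j
    simp only [VinbergData.mul, VinbergData.adj] at h
    rw [← Finset.add_sum_erase _ _ (Finset.mem_univ j),
      ← Finset.add_sum_erase _ _ (Finset.mem_univ j)] at h
    simp only [eadj_diag, emul_diag_right, scal_lowExt] at h
    refine add_right_cancel (h.trans (congrArg _ (Finset.sum_congr rfl fun k hk => ?_)))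
    by_cases hkj : k ≤ j
    · have hlt := lt_of_le_of_ne hkj (Finset.ne_of_mem_erase hk)
      rw [ih k hlt, ih k hlt]
    · rw [lowExt_of_not_le x hkj, lowExt_of_not_le y hkj, map_zero, map_zero, map_zero]
  have hd : V.diagEntry j x = V.diagEntry j y := by
    have h := congrArg (V.scal j) (hmul j)
    rw [map_smul, map_smul, scal_lowExt, scal_lowExt] at h
    exact (mul_self_inj (hx j).le (hy j).le).1 h
  intro i
  have h := hmul i
  rw [hd] at h
  exact smul_right_injective _ (hy j).ne' h

-- The same recursion on rows, downwards from the maximal indices: (x^* x)_ij is x_ii x_ij plus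
-- terms from rows k > i.
open Classical in
theorem dualSq_injOn : Set.InjOn V.dualSq V.posSet := by
  intro x hx y hy hxy
  have hz : ∀ i j, V.mul (V.adj (lowExt x)) (lowExt x) i j =
      V.mul (V.adj (lowExt y)) (lowExt y) i j := fun i j =>
    congrFun (congrFun (congrArg Subtype.val hxy) i) j
  suffices h : ∀ i j, lowExt x i j = lowExt y i j from
    lowExt_injective (funext fun i => funext fun j => h i j)
  intro i
  induction i using WellFoundedGT.induction with
  | ind i ih =>
  have hmul : ∀ j, V.diagEntry i x • lowExt x i j = V.diagEntry i y • lowExt y i j := by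
    intro j
    have h := hz i j
    simp only [VinbergData.mul, VinbergData.adj] at h
    rw [← Finset.add_sum_erase _ _ (Finset.mem_univ i),
      ← Finset.add_sum_erase _ _ (Finset.mem_univ i)] at h
    simp only [eadj_diag, emul_diag_left, scal_lowExt] at h
    refine add_right_cancel (h.trans (congrArg _ (Finset.sum_congr rfl fun k hk => ?_)))
    by_cases hkj : i ≤ k
    · have hlt := lt_of_le_of_ne hkj (Finset.ne_of_mem_erase hk).symm
      rw [ih k hlt, ih k hlt]
    · rw [lowExt_of_not_le x hkj, lowExt_of_not_le y hkj, map_zero, map_zero,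
        LinearMap.zero_apply, LinearMap.zero_apply]
  have hd : V.diagEntry i x = V.diagEntry i y := by
    have h := congrArg (V.scal i) (hmul i)
    rw [map_smul, map_smul, scal_lowExt, scal_lowExt] at h
    exact (mul_self_inj (hx i).le (hy i).le).1 h
  intro j
  have h := hmul j
  rw [hd] at h
  exact smul_right_injective _ (hy i).ne' h

theorem mem_cone_iff {Z : V.herm} : Z ∈ V.cone ↔ ∃ x ∈ V.posSet, V.hermSq x = Z := by
  constructor
  · rintro ⟨T, hT, hZ⟩
    obtain ⟨x, hx, rfl⟩ := V.exists_lowExt_of_mem_lowerPos hT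
    exact ⟨x, hx, Subtype.ext hZ⟩
  · rintro ⟨x, hx, rfl⟩
    exact ⟨_, V.lowExt_mem_lowerPos hx, rfl⟩

/-- Injectivity of the factorization pins down the arbitrarily chosen factor. -/
theorem factor_hermSq {x : LowSp A} (hx : x ∈ V.posSet) : V.factor (V.hermSq x) = lowExt x := by
  have h : V.factor (V.hermSq x) ∈ V.lowerPos ∧
      V.mul (V.factor (V.hermSq x)) (V.adj (V.factor (V.hermSq x))) = V.hermSq x :=
    Classical.epsilon_spec (p := fun T => T ∈ V.lowerPos ∧ V.mul T (V.adj T) = V.hermSq x)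
      ⟨lowExt x, V.lowExt_mem_lowerPos hx, rfl⟩
  obtain ⟨y, hy, he⟩ := V.exists_lowExt_of_mem_lowerPos h.1
  rw [← he] at h ⊢
  rw [V.hermSq_injOn hy hx (Subtype.ext h.2)]

theorem dualFactor_dualSq {x : LowSp A} (hx : x ∈ V.posSet) :
    V.dualFactor (V.dualSq x) = lowExt x := by
  have h : V.dualFactor (V.dualSq x) ∈ V.lowerPos ∧
      V.mul (V.adj (V.dualFactor (V.dualSq x))) (V.dualFactor (V.dualSq x)) = V.dualSq x :=
    Classical.epsilon_spec (p := fun T => T ∈ V.lowerPos ∧ V.mul (V.adj T) T = V.dualSq x)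
      ⟨lowExt x, V.lowExt_mem_lowerPos hx, rfl⟩
  obtain ⟨y, hy, he⟩ := V.exists_lowExt_of_mem_lowerPos h.1
  rw [← he] at h ⊢
  rw [V.dualSq_injOn hy hx (Subtype.ext h.2)]

open Classical in
theorem genPower_hermSq (χ : I → ℝ) {x : LowSp A} (hx : x ∈ V.posSet) :
    V.genPower χ (V.hermSq x) = ∏ i, (V.diagEntry i x ^ 2) ^ χ i := by
  rw [genPower]
  refine Finset.prod_congr rfl fun k _ => ?_
  congr 1
  simp only [largeMinor, strictMinor, V.factor_hermSq hx, scal_lowExt]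
  have : Finset.univ.filter (· ≤ k) = insert k (Finset.univ.filter (· < k)) := by
    ext j
    simp [le_iff_eq_or_lt]
  rw [this, Finset.prod_insert (by simp), mul_div_assoc, div_self, _root_.mul_one]
  exact Finset.prod_ne_zero_iff.2 fun j _ => pow_ne_zero _ (hx j).ne'

section Group

variable [∀ i j, FiniteDimensional ℝ (A i j)]

theorem det_lowMul_pos {x : LowSp A} (hx : x ∈ V.posSet) : 0 < LinearMap.det (V.lowMul x) := by
  rw [det_lowMul]
  exact Finset.prod_pos fun i _ => pow_pos (hx i) _

theorem det_sqDeriv_pos {x : LowSp A} (hx : x ∈ V.posSet) : 0 < LinearMap.det (V.sqDeriv x) := by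
  rw [det_sqDeriv]
  exact Finset.prod_pos fun i _ => mul_pos two_pos (pow_pos (hx i) _)

/-- Left multiplication has nonzero determinant, so it reaches the unit. Together with associativity
and a right unit, a right inverse already gives a group. -/
theorem exists_lowMul_eq_lowOne {x : LowSp A} (hx : x ∈ V.posSet) :
    ∃ y ∈ V.posSet, V.lowMul x y = V.lowOne := by
  obtain ⟨y, hy⟩ := (LinearMap.equivOfDetNeZero _ (V.det_lowMul_pos hx).ne').surjective V.lowOne
  have hy' : V.lowMul x y = V.lowOne := hy
  refine ⟨y, fun i => ?_, hy'⟩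
  have h := V.diagEntry_lowMul i x y
  rw [hy', diagEntry_lowOne] at h
  exact (pos_iff_pos_of_mul_pos (h ▸ one_pos)).1 (hx i)

/-- The group structure of `𝒯_l^+`. -/
noncomputable instance : Group V.posSet :=
  letI : Mul V.posSet := ⟨fun x y => ⟨V.lowMul x y, V.lowMul_mem_posSet x.2 y.2⟩⟩
  letI : One V.posSet := ⟨⟨V.lowOne, V.lowOne_mem_posSet⟩⟩
  letI : Inv V.posSet := ⟨fun x => ⟨(V.exists_lowMul_eq_lowOne x.2).choose,
    (V.exists_lowMul_eq_lowOne x.2).choose_spec.1⟩⟩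
  Group.ofRightAxioms (fun x y z => Subtype.ext (V.lowMul_assoc x y z))
    (fun x => Subtype.ext (V.lowMul_lowOne x))
    (fun x => Subtype.ext (V.exists_lowMul_eq_lowOne x.2).choose_spec.2)

theorem coe_mul (g h : V.posSet) : ((g * h : V.posSet) : LowSp A) = V.lowMul g h := rfl

theorem coe_one : ((1 : V.posSet) : LowSp A) = V.lowOne := rfl

theorem diagEntry_inv (i : I) (g : V.posSet) :
    V.diagEntry i ((g⁻¹ : V.posSet) : LowSp A) = (V.diagEntry i g)⁻¹ := by
  have h := V.diagEntry_lowMul i g (g⁻¹ : V.posSet)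
  rw [← coe_mul, mul_inv_cancel, coe_one, diagEntry_lowOne] at h
  exact eq_inv_of_mul_eq_one_right h.symm

theorem lowerInv_lowExt (g : V.posSet) :
    V.lowerInv (lowExt (g : LowSp A)) = lowExt ((g⁻¹ : V.posSet) : LowSp A) := by
  have h := Classical.epsilon_spec (p := fun S => S ∈ V.lowerPos ∧
    V.mul (lowExt (g : LowSp A)) S = V.one ∧ V.mul S (lowExt (g : LowSp A)) = V.one)
    ⟨lowExt ((g⁻¹ : V.posSet) : LowSp A), V.lowExt_mem_lowerPos (g⁻¹).2, by
      rw [← lowExt_lowMul, ← coe_mul, mul_inv_cancel, coe_one, lowExt_lowOne], by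
      rw [← lowExt_lowMul, ← coe_mul, inv_mul_cancel, coe_one, lowExt_lowOne]⟩
  change V.lowerInv (lowExt (g : LowSp A)) ∈ V.lowerPos ∧
    V.mul _ (V.lowerInv (lowExt (g : LowSp A))) = V.one ∧ _ at h
  obtain ⟨s, hs, he⟩ := V.exists_lowExt_of_mem_lowerPos h.1
  rw [← he] at h ⊢
  have h1 : g * ⟨s, hs⟩ = 1 := by
    apply Subtype.ext
    apply lowExt_injective
    rw [coe_mul, coe_one, lowExt_lowMul, lowExt_lowOne]
    exact h.2.1
  rw [← eq_inv_of_mul_eq_one_right h1]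

theorem dualInv_dualSq (g : V.posSet) :
    V.dualInv (V.dualSq (g : LowSp A)) = V.hermSq ((g⁻¹ : V.posSet) : LowSp A) := by
  rw [dualInv, V.dualFactor_dualSq g.2, lowerInv_lowExt, coe_hermSq]

theorem genPower_dualInv (χ : I → ℝ) (g : V.posSet) :
    V.genPower χ (V.dualInv (V.dualSq (g : LowSp A))) =
      ∏ i, ((V.diagEntry i g)⁻¹ ^ 2) ^ χ i := by
  rw [dualInv_dualSq, genPower_hermSq V χ (g⁻¹).2]
  simp_rw [diagEntry_inv]

end Group

/-! ### The closed cone and the dual cone -/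

theorem sqNorm_eq_tr_hermSq (x : LowSp A) : V.sqNorm x = V.tr (V.hermSq x) := rfl

open Classical in
theorem norm_sq_le_sqNorm (x : LowSp A) : ‖x‖ ^ 2 ≤ V.sqNorm x := by
  have h : ‖x‖ ≤ √(V.sqNorm x) := by
    refine (pi_norm_le_iff_of_nonneg (Real.sqrt_nonneg _)).2 fun p => Real.le_sqrt_of_sq_le ?_
    rw [sqNorm_eq]
    exact Finset.single_le_sum (f := fun p => ‖x p‖ ^ 2) (fun _ _ => sq_nonneg _)
      (Finset.mem_univ p)
  rw [sqNorm_eq] at h ⊢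
  exact (Real.le_sqrt (norm_nonneg _) (Finset.sum_nonneg fun _ _ => sq_nonneg _)).1 h

theorem sqNorm_pos {x : LowSp A} (hx : x ≠ 0) : 0 < V.sqNorm x :=
  V.tr_pos _ fun h => hx (lowExt_injective (by rw [h, map_zero]))

theorem hermSq_zero : V.hermSq 0 = 0 := by
  apply Subtype.ext
  rw [coe_hermSq, map_zero]
  exact LinearMap.map_zero₂ V.mulBilin _

theorem hermSq_ne_zero {x : LowSp A} (hx : x ≠ 0) : V.hermSq x ≠ 0 := by
  intro h
  have := V.sqNorm_pos hx
  rw [sqNorm_eq_tr_hermSq, h] at this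
  exact this.ne' (map_zero V.trLin)

section Topology

variable [∀ i j, FiniteDimensional ℝ (A i j)]

theorem continuous_diagEntry (i : I) : Continuous (V.diagEntry i) :=
  LinearMap.continuous_of_finiteDimensional _

theorem continuous_tr : Continuous V.tr :=
  LinearMap.continuous_of_finiteDimensional V.trLin

theorem continuous_mul : Continuous fun p : VinMat A × VinMat A => V.mul p.1 p.2 :=
  V.mulBilin.toContinuousBilinearMap.continuous₂

theorem continuous_lowExt : Continuous (lowExt : LowSp A →ₗ[ℝ] VinMat A) :=
  LinearMap.continuous_of_finiteDimensional _

theorem continuous_lowRes : Continuous (lowRes : VinMat A →ₗ[ℝ] LowSp A) :=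
  LinearMap.continuous_of_finiteDimensional _

theorem continuous_lowMul : Continuous fun p : LowSp A × LowSp A => V.lowMul p.1 p.2 :=
  continuous_lowRes.comp (V.continuous_mul.comp
    ((continuous_lowExt.comp continuous_fst).prodMk (continuous_lowExt.comp continuous_snd)))

theorem continuous_hermSq : Continuous V.hermSq := by
  have h2 : Continuous V.adj := LinearMap.continuous_of_finiteDimensional V.adjLin
  exact (V.continuous_mul.comp (continuous_lowExt.prodMk (h2.comp continuous_lowExt))).subtype_mk _

-- The trace of x x^* dominates ‖x‖², so preimages of compact sets stay bounded and the map is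
-- proper.
open Classical in
theorem isClosedMap_hermSq : IsClosedMap V.hermSq := by
  refine (isProperMap_iff_tendsto_cocompact.2 ⟨V.continuous_hermSq, ?_⟩).isClosedMap
  have htr : Continuous fun Z : V.herm => V.tr Z := V.continuous_tr.comp continuous_subtype_val
  have h1 : Filter.Tendsto (fun x => V.tr (V.hermSq x)) (Filter.cocompact (LowSp A))
      Filter.atTop := by
    refine Filter.tendsto_atTop_mono (fun x => V.norm_sq_le_sqNorm x) ?_
    exact (Filter.tendsto_pow_atTop two_ne_zero).comp (tendsto_norm_cocompact_atTop (E := LowSp A))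
  rw [Filter.hasBasis_cocompact.tendsto_right_iff]
  intro K hK
  obtain ⟨M, hM⟩ := (hK.image htr).bddAbove
  filter_upwards [h1.eventually_gt_atTop M] with x hx hxK
  exact absurd (hM (Set.mem_image_of_mem _ hxK)) (not_le.2 hx)

/-- Since the squaring map is closed, the image of the triangular matrices with nonnegative diagonal
is a closed set containing the cone. -/
theorem exists_hermSq_of_mem_closure {Z : V.herm} (hZ : Z ∈ closure V.cone) :
    ∃ x, (∀ i, 0 ≤ V.diagEntry i x) ∧ V.hermSq x = Z := by
  have hcl : IsClosed (V.hermSq '' {x | ∀ i, 0 ≤ V.diagEntry i x}) := by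
    apply V.isClosedMap_hermSq
    simp only [Set.ofPred_forall]
    exact isClosed_iInter fun i => isClosed_le continuous_const (V.continuous_diagEntry i)
  refine closure_minimal ?_ hcl hZ
  intro W hW
  obtain ⟨x, hx, rfl⟩ := V.mem_cone_iff.1 hW
  exact ⟨x, fun i => (hx i).le, rfl⟩

theorem hermSq_mem_closure {x : LowSp A} (hx : ∀ i, 0 ≤ V.diagEntry i x) :
    V.hermSq x ∈ closure V.cone := by
  have hc : Continuous fun ε : ℝ => V.hermSq (x + ε • V.lowOne) :=
    V.continuous_hermSq.comp (continuous_const.add (continuous_id.smul continuous_const))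
  have ht : Filter.Tendsto (fun ε : ℝ => V.hermSq (x + ε • V.lowOne)) (nhdsWithin 0 (Set.Ioi 0))
      (nhds (V.hermSq x)) := by
    have := (hc.tendsto 0).mono_left (nhdsWithin_le_nhds (s := Set.Ioi 0))
    simpa using this
  refine mem_closure_of_tendsto ht ?_
  filter_upwards [self_mem_nhdsWithin] with ε hε
  refine V.mem_cone_iff.2 ⟨_, fun i => ?_, rfl⟩
  rw [map_add, map_smul, diagEntry_lowOne, smul_eq_mul, _root_.mul_one]
  exact add_pos_of_nonneg_of_pos (hx i) hε

theorem mem_dualCone_iff {θ : V.herm} : θ ∈ V.dualCone ↔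
    ∀ x, (∀ i, 0 ≤ V.diagEntry i x) → x ≠ 0 → 0 < V.tr (V.mul θ (V.hermSq x)) := by
  constructor
  · intro h x hx hx0
    exact h _ (V.hermSq_mem_closure hx) (V.hermSq_ne_zero hx0)
  · intro h Z hZ hZ0
    obtain ⟨x, hx, rfl⟩ := V.exists_hermSq_of_mem_closure hZ
    exact h x hx fun h0 => hZ0 (by rw [h0, hermSq_zero])

theorem dualSq_mem_dualCone {q : LowSp A} (hq : q ∈ V.posSet) : V.dualSq q ∈ V.dualCone := by
  refine V.mem_dualCone_iff.2 fun x _ hx => ?_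
  rw [tr_dualSq_mul_hermSq]
  refine V.sqNorm_pos fun h => hx ?_
  refine (LinearMap.equivOfDetNeZero _ (V.det_lowMul_pos hq).ne').injective ?_
  rw [map_zero]
  exact h

end Topology

end VinbergAlgebra

namespace VinbergAlgebra

open VinbergData

variable {I : Type*} [Fintype I] [PartialOrder I] {A : I → I → Type*}
  [∀ i j, NormedAddCommGroup (A i j)] [∀ i j, InnerProductSpace ℝ (A i j)]
  (V : VinbergAlgebra A)

/-! ### The factorization of the elements of the dual cone -/

/-- Testing against Z = η and using positivity of the trace form shows that the pairing is
nondegenerate. -/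
theorem eq_zero_of_tr_mul_eq_zero {η : V.herm} (h : ∀ Z : V.herm, V.tr (V.mul η Z) = 0) :
    η = 0 := by
  by_contra h0
  have hpos := V.tr_pos (η : VinMat A) fun e => h0 (Subtype.ext e)
  rw [V.mem_herm.1 η.2] at hpos
  exact hpos.ne' (h η)

/-- The bilinear form `(x, y) ↦ tr (θ (x y^*))`. -/
noncomputable def trForm (θ : VinMat A) : LowSp A →ₗ[ℝ] LowSp A →ₗ[ℝ] ℝ :=
  (V.mulBilin.compl₁₂ lowExt (V.adjLin ∘ₗ lowExt)).compr₂ (V.trLin ∘ₗ V.mulBilin θ)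

theorem trForm_apply (θ : VinMat A) (x y : LowSp A) :
    V.trForm θ x y = V.tr (V.mul θ (V.mul (lowExt x) (V.adj (lowExt y)))) := rfl

theorem trForm_self (θ : VinMat A) (x : LowSp A) :
    V.trForm θ x x = V.tr (V.mul θ (V.hermSq x)) := rfl

theorem trForm_comm (θ : V.herm) (x y : LowSp A) : V.trForm θ x y = V.trForm θ y x := by
  rw [trForm_apply, trForm_apply, ← V.tr_adj, V.adj_mul, V.mem_herm.1 θ.2, V.adj_mul, V.adj_adj,
    V.tr_comm]

/-- The Euclidean inner product of lower triangular matrices, `tr (x y^*)`. -/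
noncomputable def lowInner : LowSp A →ₗ[ℝ] LowSp A →ₗ[ℝ] ℝ :=
  (V.mulBilin.compl₁₂ lowExt (V.adjLin ∘ₗ lowExt)).compr₂ V.trLin

theorem lowInner_apply (x y : LowSp A) :
    V.lowInner x y = V.tr (V.mul (lowExt x) (V.adj (lowExt y))) := rfl

theorem lowInner_comm (x y : LowSp A) : V.lowInner x y = V.lowInner y x := by
  rw [lowInner_apply, lowInner_apply, ← V.tr_adj, V.adj_mul, V.adj_adj]

theorem lowInner_lowOne (x : LowSp A) : V.lowInner x V.lowOne = ∑ i, V.diagEntry i x := by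
  have h : V.adj V.one = V.one := by
    have := V.dualSq_lowOne
    rwa [coe_dualSq, lowExt_lowOne, V.mul_one] at this
  rw [lowInner_apply, lowExt_lowOne, h, V.mul_one]
  exact Finset.sum_congr rfl fun i _ => V.scal_lowExt i x

/-- Both sides are symmetric bilinear in x and y and agree on the diagonal, so polarization applies.
-/
theorem trForm_dualSq (q x y : LowSp A) :
    V.trForm (V.dualSq q) x y = V.lowInner (V.lowMul q x) (V.lowMul q y) := by
  have h : ∀ z, V.trForm (V.dualSq q) z z = V.lowInner (V.lowMul q z) (V.lowMul q z) :=
    V.tr_dualSq_mul_hermSq q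
  have h1 := h (x + y)
  simp only [map_add, LinearMap.add_apply] at h1
  rw [h x, h y, V.trForm_comm (V.dualSq q) y x, V.lowInner_comm (V.lowMul q y) (V.lowMul q x)] at h1
  linarith

theorem dualSq_smul (c : ℝ) (q : LowSp A) : V.dualSq (c • q) = c ^ 2 • V.dualSq q := by
  apply Subtype.ext
  have : (V.dualSq (c • q) : VinMat A) =
      V.mulBilin (V.adjLin (lowExt (c • q))) (lowExt (c • q)) := rfl
  rw [this]
  simp only [map_smul, LinearMap.smul_apply, smul_smul, ← sq]
  rfl

section

variable [∀ i j, FiniteDimensional ℝ (A i j)]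

/-- The differential of `x ↦ x x^*` at a point of `𝒯_l^+` is onto the Hermitian matrices. -/
theorem exists_mul_adj_add_eq {s : LowSp A} (hs : s ∈ V.posSet) (Z : V.herm) :
    ∃ u : LowSp A, V.mul (lowExt s) (V.adj (lowExt u)) + V.mul (lowExt u) (V.adj (lowExt s)) =
      (Z : VinMat A) := by
  obtain ⟨u, hu⟩ := (LinearMap.equivOfDetNeZero _ (V.det_sqDeriv_pos hs).ne').surjective
    (V.coordsLin Z)
  refine ⟨u, ?_⟩
  have hmem : V.mul (lowExt s) (V.adj (lowExt u)) + V.mul (lowExt u) (V.adj (lowExt s)) ∈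
      V.herm := by
    rw [mem_herm, ← adjLin_apply, map_add, adjLin_apply, adjLin_apply, V.adj_mul, V.adj_mul,
      adj_adj, adj_adj, add_comm]
  exact congrArg Subtype.val (V.coordsLin_injective (a₁ := ⟨_, hmem⟩) (a₂ := Z) hu)

-- On the compact part of the unit sphere with nonnegative diagonal the quadratic form has a
-- positive minimum c; by homogeneity it is at least c‖x‖², so the sublevel set is bounded.
open Classical in
theorem isCompact_trForm_le_one {θ : V.herm} (hθ : θ ∈ V.dualCone) :
    IsCompact {x : LowSp A | (∀ i, 0 ≤ V.diagEntry i x) ∧ V.trForm θ x x ≤ 1} := by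
  have hcont : Continuous fun x : LowSp A => V.trForm θ x x := by
    have h : Continuous fun Z : VinMat A => V.trLin (V.mulBilin θ Z) :=
      LinearMap.continuous_of_finiteDimensional (V.trLin ∘ₗ V.mulBilin θ)
    exact h.comp (continuous_subtype_val.comp V.continuous_hermSq)
  have hC : IsClosed {x : LowSp A | ∀ i, 0 ≤ V.diagEntry i x} := by
    simp only [Set.ofPred_forall]
    exact isClosed_iInter fun i => isClosed_le continuous_const (V.continuous_diagEntry i)
  have hpos := V.mem_dualCone_iff.1 hθ
  obtain ⟨c, hc, hcx⟩ : ∃ c : ℝ, 0 < c ∧ ∀ x : LowSp A, (∀ i, 0 ≤ V.diagEntry i x) → ‖x‖ = 1 →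
      c ≤ V.trForm θ x x := by
    have hS : IsCompact ({x : LowSp A | ∀ i, 0 ≤ V.diagEntry i x} ∩ Metric.sphere 0 1) :=
      (isCompact_sphere 0 1).inter_left hC
    rcases Set.eq_empty_or_nonempty
      ({x : LowSp A | ∀ i, 0 ≤ V.diagEntry i x} ∩ Metric.sphere 0 1) with he | hne
    · refine ⟨1, one_pos, fun x hx h1 => ?_⟩
      have : x ∈ ({x : LowSp A | ∀ i, 0 ≤ V.diagEntry i x} ∩ Metric.sphere 0 1) :=
        ⟨hx, by simpa using h1⟩
      rw [he] at this
      exact this.elim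
    · obtain ⟨x, hx, hmin⟩ := hS.exists_isMinOn hne hcont.continuousOn
      have hx0 : x ≠ 0 := by
        rintro rfl
        simpa using hx.2
      exact ⟨_, hpos x hx.1 hx0, fun y hy h1 => hmin ⟨hy, by simpa using h1⟩⟩
  refine Metric.isCompact_of_isClosed_isBounded
    (hC.inter (isClosed_le hcont continuous_const)) ?_
  refine isBounded_iff_forall_norm_le.2 ⟨√(1 / c), fun x hx => ?_⟩
  refine Real.le_sqrt_of_sq_le ?_
  rcases eq_or_ne x 0 with rfl | hx0
  · rw [norm_zero, zero_pow two_ne_zero]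
    exact (one_div_pos.2 hc).le
  · have hn : 0 < ‖x‖ := norm_pos_iff.2 hx0
    have h := hcx (‖x‖⁻¹ • x) (fun i => by
      rw [map_smul, smul_eq_mul]
      exact mul_nonneg (inv_nonneg.2 hn.le) (hx.1 i))
      (by rw [norm_smul, norm_inv, norm_norm, inv_mul_cancel₀ hn.ne'])
    simp only [map_smul, LinearMap.smul_apply, smul_eq_mul] at h
    have h1 := hx.2
    rw [le_div_iff₀ hc]
    calc ‖x‖ ^ 2 * c ≤ ‖x‖ ^ 2 * (‖x‖⁻¹ * (‖x‖⁻¹ * V.trForm θ x x)) := by gcongr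
      _ = V.trForm θ x x := by field_simp
      _ ≤ 1 := h1

theorem continuous_prod_diagEntry : Continuous fun x : LowSp A => ∏ i, V.diagEntry i x :=
  continuous_finsetProd _ fun i _ => V.continuous_diagEntry i

/-- A point of `𝒯_l^+` at which `∏ s_{ii}` is maximal subject to `tr (θ s s^*) ≤ 1`. -/
theorem exists_max_prod_diag [Nonempty I] {θ : V.herm} (hθ : θ ∈ V.dualCone) :
    ∃ s ∈ V.posSet, V.trForm θ s s = 1 ∧ ∀ y ∈ V.posSet,
      ∑ i, Real.log (V.diagEntry i y) ≤
        ∑ i, Real.log (V.diagEntry i s) + Fintype.card I / 2 * Real.log (V.trForm θ y y) := by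
  have hpos := V.mem_dualCone_iff.1 hθ
  have hposT : ∀ y ∈ V.posSet, 0 < V.trForm θ y y := fun y hy => by
    refine hpos y (fun i => (hy i).le) ?_
    rintro rfl
    have := hy (Classical.arbitrary I)
    rw [map_zero] at this
    exact lt_irrefl _ this
  have hscale : ∀ y ∈ V.posSet, (√(V.trForm θ y y))⁻¹ • y ∈
      {x : LowSp A | (∀ i, 0 ≤ V.diagEntry i x) ∧ V.trForm θ x x ≤ 1} := fun y hy => by
    constructor
    · intro i
      rw [map_smul, smul_eq_mul]
      exact mul_nonneg (inv_nonneg.2 (Real.sqrt_nonneg _)) (hy i).le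
    · simp only [map_smul, LinearMap.smul_apply, smul_eq_mul]
      rw [← mul_assoc, ← mul_inv, Real.mul_self_sqrt (hposT y hy).le,
        inv_mul_cancel₀ (hposT y hy).ne']
  obtain ⟨s, hsK, hmax⟩ := (V.isCompact_trForm_le_one hθ).exists_isMaxOn
    ⟨_, hscale _ V.lowOne_mem_posSet⟩ V.continuous_prod_diagEntry.continuousOn
  -- The normalized competitor y / √tr(θ y y^*) is admissible, and the diagonal product is
  -- homogeneous of degree |I|. Taking logarithms removes the constraint.
  have hle : ∀ y ∈ V.posSet, (√(V.trForm θ y y))⁻¹ ^ Fintype.card I * ∏ i, V.diagEntry i y ≤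
      ∏ i, V.diagEntry i s := fun y hy => by
    have h := hmax (hscale y hy)
    simpa only [Set.mem_ofPred_eq, map_smul, smul_eq_mul, Finset.prod_mul_distrib,
      Finset.prod_const, Finset.card_univ] using h
  have hs : s ∈ V.posSet := by
    -- The rescaled unit has a positive diagonal product, so the maximizer cannot lie on the
    -- boundary.
    have h0 : 0 < ∏ i, V.diagEntry i s := by
      refine lt_of_lt_of_le ?_ (hle _ V.lowOne_mem_posSet)
      refine mul_pos (pow_pos (inv_pos.2 (Real.sqrt_pos.2 (hposT _ V.lowOne_mem_posSet))) _) ?_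
      exact Finset.prod_pos fun i _ => V.lowOne_mem_posSet i
    intro i
    exact lt_of_le_of_ne (hsK.1 i) (Finset.prod_ne_zero_iff.1 h0.ne' i (Finset.mem_univ i)).symm
  have hlog : ∀ y ∈ V.posSet, ∑ i, Real.log (V.diagEntry i y) ≤
      ∑ i, Real.log (V.diagEntry i s) + Fintype.card I / 2 * Real.log (V.trForm θ y y) := by
    intro y hy
    have hq := Real.sqrt_pos.2 (hposT y hy)
    have h := Real.log_le_log (mul_pos (pow_pos (inv_pos.2 hq) _)
      (Finset.prod_pos fun i _ => hy i)) (hle y hy)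
    rw [Real.log_mul (pow_pos (inv_pos.2 hq) _).ne' (Finset.prod_pos fun i _ => hy i).ne',
      Real.log_pow, Real.log_inv, Real.log_sqrt (hposT y hy).le,
      Real.log_prod fun i _ => (hy i).ne', Real.log_prod fun i _ => (hs i).ne'] at h
    linarith
  refine ⟨s, hs, le_antisymm hsK.2 ?_, hlog⟩
  -- Comparing s with itself gives 0 ≤ log tr(θ s s^*), so the constraint is active at s.
  have h := hlog s hs
  have hcard : (0 : ℝ) < Fintype.card I := by exact_mod_cast Fintype.card_pos
  by_contra hlt
  have := Real.log_neg (hposT s hs) (not_le.1 hlt)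
  nlinarith

/-- Let s maximize ∏ s_ii under tr(θ s s^*) ≤ 1, and let g = s⁻¹. The first-order condition reads
|I| tr(θ s u^*) = ∑ u_ii/s_ii. The right side is the trace of gu, that is ⟨gs, gu⟩ = tr(g^*g (s
u^*)). As the elements s u^* + u s^* exhaust the Hermitian matrices, |I| θ = g^*g. -/
theorem exists_dualSq_of_mem_dualCone {θ : V.herm} (hθ : θ ∈ V.dualCone) :
    ∃ q ∈ V.posSet, V.dualSq q = θ := by
  rcases isEmpty_or_nonempty I with hI | hI
  · exact ⟨0, fun i => isEmptyElim i, Subtype.ext (Subsingleton.elim _ _)⟩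
  obtain ⟨s, hs, hs1, hmax⟩ := V.exists_max_prod_diag hθ
  have hcard : (0 : ℝ) < Fintype.card I := by exact_mod_cast Fintype.card_pos
  have hcrit : ∀ u, Fintype.card I * V.trForm θ s u =
      ∑ i, V.diagEntry i u / V.diagEntry i s := by
    intro u
    have hd1 : HasDerivAt (fun ε : ℝ => V.trForm θ (s + ε • u) (s + ε • u))
        (2 * V.trForm θ s u) 0 := by
      have : (fun ε : ℝ => V.trForm θ (s + ε • u) (s + ε • u)) = fun ε : ℝ =>
          V.trForm θ s s + ε * (2 * V.trForm θ s u) + ε ^ 2 * V.trForm θ u u := by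
        ext ε
        simp only [map_add, map_smul, LinearMap.add_apply, LinearMap.smul_apply, smul_eq_mul,
          V.trForm_comm θ u s]
        ring
      rw [this]
      have h := (((hasDerivAt_id (0 : ℝ)).mul_const (2 * V.trForm θ s u)).const_add
        (V.trForm θ s s)).fun_add ((hasDerivAt_pow 2 (0 : ℝ)).mul_const (V.trForm θ u u))
      simpa using h
    have hd2 : ∀ i, HasDerivAt (fun ε : ℝ => Real.log (V.diagEntry i (s + ε • u)))
        (V.diagEntry i u / V.diagEntry i s) 0 := by
      intro i
      have h0 : HasDerivAt (fun ε : ℝ => V.diagEntry i (s + ε • u)) (V.diagEntry i u) 0 := by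
        simp only [map_add, map_smul, smul_eq_mul]
        simpa using ((hasDerivAt_id (0 : ℝ)).mul_const (V.diagEntry i u)).const_add
          (V.diagEntry i s)
      simpa using h0.log (by simpa using (hs i).ne')
    have hd3 : HasDerivAt (fun ε : ℝ => Fintype.card I / 2 *
        Real.log (V.trForm θ (s + ε • u) (s + ε • u)) -
        ∑ i, Real.log (V.diagEntry i (s + ε • u)))
        (Fintype.card I / 2 * (2 * V.trForm θ s u) -
          ∑ i, V.diagEntry i u / V.diagEntry i s) 0 := by
      have h := ((hd1.log (by simp [hs1])).const_mul ((Fintype.card I : ℝ) / 2)).fun_sub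
        (HasDerivAt.fun_sum fun i (_ : i ∈ Finset.univ) => hd2 i)
      simpa [hs1] using h
    have hmin : IsLocalMin (fun ε : ℝ => Fintype.card I / 2 *
        Real.log (V.trForm θ (s + ε • u) (s + ε • u)) -
        ∑ i, Real.log (V.diagEntry i (s + ε • u))) 0 := by
      have hev : ∀ᶠ ε : ℝ in nhds 0, s + ε • u ∈ V.posSet := by
        refine Filter.eventually_all.2 fun i => ?_
        have hc : Continuous fun ε : ℝ => V.diagEntry i (s + ε • u) :=
          (V.continuous_diagEntry i).comp
            (continuous_const.add (continuous_id.smul continuous_const))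
        refine hc.continuousAt.eventually (lt_mem_nhds ?_)
        simpa using hs i
      filter_upwards [hev] with ε hε
      have := hmax _ hε
      simp only [zero_smul, add_zero, hs1, Real.log_one, mul_zero, zero_sub]
      linarith
    have := hmin.hasDerivAt_eq_zero hd3
    linarith
  have hg := V.trForm_dualSq ((⟨s, hs⟩⁻¹ : V.posSet) : LowSp A)
  set g : V.posSet := ⟨s, hs⟩⁻¹ with hgdef
  have hgs : V.lowMul g s = V.lowOne := by
    have : g * ⟨s, hs⟩ = 1 := inv_mul_cancel _
    exact congrArg Subtype.val this
  have hη : θ - (Fintype.card I : ℝ)⁻¹ • V.dualSq (g : LowSp A) = 0 := by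
    refine V.eq_zero_of_tr_mul_eq_zero fun Z => ?_
    obtain ⟨u, hu⟩ := V.exists_mul_adj_add_eq hs Z
    have h1 : V.tr (V.mul θ Z) = 2 * V.trForm θ s u := by
      rw [← hu, two_mul]
      nth_rewrite 2 [V.trForm_comm θ s u]
      rw [trForm_apply, trForm_apply, ← mulBilin_apply, ← trLin_apply, map_add, map_add]
      rfl
    have h2 : V.tr (V.mul (V.dualSq (g : LowSp A)) Z) =
        2 * V.trForm (V.dualSq (g : LowSp A)) s u := by
      rw [← hu, two_mul]
      nth_rewrite 2 [V.trForm_comm (V.dualSq (g : LowSp A)) s u]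
      rw [trForm_apply, trForm_apply, ← mulBilin_apply, ← trLin_apply, map_add, map_add]
      rfl
    -- Since gs is the unit, the inner product ⟨gs, gu⟩ is the sum of the diagonal entries u_ii/s_ii
    -- of gu.
    have h3 : V.trForm (V.dualSq (g : LowSp A)) s u = Fintype.card I * V.trForm θ s u := by
      rw [hg, hgs, lowInner_comm, lowInner_lowOne, hcrit]
      refine Finset.sum_congr rfl fun i _ => ?_
      rw [diagEntry_lowMul, hgdef, diagEntry_inv, inv_mul_eq_div]
    have h4 : V.tr (V.mul (θ - (Fintype.card I : ℝ)⁻¹ • V.dualSq (g : LowSp A) : V.herm) Z) =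
        V.tr (V.mul θ Z) -
          (Fintype.card I : ℝ)⁻¹ * V.tr (V.mul (V.dualSq (g : LowSp A)) Z) := by
      simp only [← mulBilin_apply, ← trLin_apply]
      rw [Submodule.coe_sub, Submodule.coe_smul, map_sub, map_smul, LinearMap.sub_apply,
        LinearMap.smul_apply, map_sub, map_smul, smul_eq_mul]
    rw [h4, h1, h2, h3]
    field_simp
    ring
  refine ⟨√((Fintype.card I : ℝ)⁻¹) • (g : LowSp A), fun i => ?_, ?_⟩
  · rw [map_smul, smul_eq_mul]
    exact mul_pos (Real.sqrt_pos.2 (inv_pos.2 hcard)) (g.2 i)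
  · rw [dualSq_smul, Real.sq_sqrt (inv_pos.2 hcard).le]
    exact (sub_eq_zero.1 hη).symm

end

end VinbergAlgebra

theorem LinearMap.exists_abs_apply_self_le {E : Type*} [NormedAddCommGroup E] [NormedSpace ℝ E]
    [FiniteDimensional ℝ E] (B : E →ₗ[ℝ] E →ₗ[ℝ] ℝ) : ∃ C, 0 ≤ C ∧ ∀ x, |B x x| ≤ C * ‖x‖ ^ 2 := by
  refine ⟨‖B.toContinuousBilinearMap‖, ContinuousLinearMap.opNorm_nonneg _, fun x => ?_⟩
  rw [sq, ← mul_assoc]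
  exact B.toContinuousBilinearMap.le_opNorm₂ x x

namespace VinbergAlgebra

open VinbergData

variable {I : Type*} [Fintype I] [PartialOrder I] {A : I → I → Type*}
  [∀ i j, NormedAddCommGroup (A i j)] [∀ i j, InnerProductSpace ℝ (A i j)]
  (V : VinbergAlgebra A)

/-! ### Uniqueness of Riesz measures -/

/-- The pairing `(ξ, Z) ↦ tr (ξ Z)` of Hermitian matrices. -/
noncomputable def trPairing : V.herm →ₗ[ℝ] V.herm →ₗ[ℝ] ℝ :=
  (V.mulBilin.compl₁₂ V.herm.subtype V.herm.subtype).compr₂ V.trLin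

theorem trPairing_apply (ξ Z : V.herm) : V.trPairing ξ Z = V.tr (V.mul ξ Z) := rfl

variable [∀ i j, FiniteDimensional ℝ (A i j)]

theorem exists_eq_trPairing (L : V.herm →ₗ[ℝ] ℝ) : ∃ ξ, L = V.trPairing ξ := by
  have hinj : Function.Injective V.trPairing := by
    rw [← LinearMap.ker_eq_bot, LinearMap.ker_eq_bot']
    intro ξ hξ
    exact V.eq_zero_of_tr_mul_eq_zero fun Z => LinearMap.congr_fun hξ Z
  have hsurj : Function.Surjective V.trPairing :=
    (LinearMap.injective_iff_surjective_of_finrank_eq_finrank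
      (Subspace.dual_finrank_eq (K := ℝ) (V := V.herm)).symm).1 hinj
  obtain ⟨ξ, hξ⟩ := hsurj L
  exact ⟨ξ, hξ.symm⟩

open Classical in
theorem exists_sub_smul_mem_dualCone (ξ : V.herm) : ∃ ε : ℝ, 0 < ε ∧ ∀ t : ℝ, |t| < ε →
    V.dualSq V.lowOne - t • ξ ∈ V.dualCone := by
  obtain ⟨C, hC, hCx⟩ := (V.trForm ξ).exists_abs_apply_self_le
  -- The form of ξ is bounded by C times the squared norm; this radius gives |t| C < 1, and the
  -- added 1 covers C = 0.
  refine ⟨1 / (C + 1), by positivity, fun t ht => V.mem_dualCone_iff.2 fun x _ hx => ?_⟩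
  have h : V.tr (V.mul (V.dualSq V.lowOne - t • ξ : V.herm) (V.hermSq x)) =
      V.sqNorm x - t * V.trForm ξ x x := by
    rw [trForm_self, ← V.trPairing_apply, ← V.trPairing_apply, map_sub, map_smul,
      LinearMap.sub_apply, LinearMap.smul_apply, smul_eq_mul, trPairing_apply,
      tr_dualSq_mul_hermSq, lowOne_lowMul]
  rw [h]
  have h1 : |t * V.trForm ξ x x| ≤ |t| * C * V.sqNorm x := by
    rw [abs_mul, mul_assoc]
    gcongr
    exact (hCx x).trans (mul_le_mul_of_nonneg_left (V.norm_sq_le_sqNorm x) hC)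
  have h2 : |t| * C < 1 := by
    rw [lt_div_iff₀ (by positivity)] at ht
    nlinarith [abs_nonneg t]
  have h3 := V.sqNorm_pos hx
  have h4 := le_abs_self (t * V.trForm ξ x x)
  nlinarith

variable [∀ i j, MeasurableSpace (A i j)] [∀ i j, BorelSpace (A i j)]

theorem measurable_trPairing (θ : V.herm) : Measurable (V.trPairing θ) :=
  (LinearMap.continuous_of_finiteDimensional (V.trPairing θ)).measurable

theorem measurable_exp_neg_trPairing (θ : V.herm) :
    Measurable fun Z : V.herm => ENNReal.ofReal (Real.exp (-V.trPairing θ Z)) :=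
  (Real.measurable_exp.comp (V.measurable_trPairing θ).neg).ennreal_ofReal

/-- Weighting by exp(-tr Z) gives a finite measure, because its mass is the transform at e. Near the
origin on each line, the transform of the weighted measure is that of R at e - tξ, which still lies
in the dual cone. The weight is positive and finite, so it can be removed again. -/
theorem IsRiesz.unique {V : VinbergAlgebra A} {χ : I → ℝ} {R R' : Measure V.herm}
    (h : V.IsRiesz χ R) (h' : V.IsRiesz χ R') : R = R' := by
  set e : V.herm := V.dualSq V.lowOne
  set f : V.herm → ENNReal := fun Z => ENNReal.ofReal (Real.exp (-V.trPairing e Z)) with hf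
  have hfm : Measurable f := V.measurable_exp_neg_trPairing e
  have he : e ∈ V.dualCone := V.dualSq_mem_dualCone V.lowOne_mem_posSet
  have hfin : ∀ {S : Measure V.herm}, V.IsRiesz χ S → IsFiniteMeasure (S.withDensity f) :=
    fun {S} hS => isFiniteMeasure_withDensity (by
      rw [hf]
      exact (hS.2 e he).trans_ne ENNReal.ofReal_ne_top)
  have := hfin h
  have := hfin h'
  have key : R.withDensity f = R'.withDensity f := by
    refine Measure.ext_of_laplace fun L => ?_
    obtain ⟨ξ, hξ⟩ := V.exists_eq_trPairing L.toLinearMap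
    have hL : ∀ Z, L Z = V.trPairing ξ Z := fun Z => LinearMap.congr_fun hξ Z
    obtain ⟨ε, hε, hmem⟩ := V.exists_sub_smul_mem_dualCone ξ
    have hval : ∀ {S : Measure V.herm}, V.IsRiesz χ S → ∀ t : ℝ, |t| < ε →
        ∫⁻ v, ENNReal.ofReal (Real.exp (t * L v)) ∂(S.withDensity f) =
          ENNReal.ofReal (V.genPower χ (V.dualInv (e - t • ξ : V.herm))) := by
      intro S hS t ht
      rw [← hS.2 _ (hmem t ht), lintegral_withDensity_eq_lintegral_mul _ hfm (by fun_prop)]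
      refine lintegral_congr fun Z => ?_
      rw [Pi.mul_apply, hf, ← ENNReal.ofReal_mul (Real.exp_pos _).le, ← Real.exp_add, hL]
      congr 2
      rw [← V.trPairing_apply, map_sub, map_smul, LinearMap.sub_apply, LinearMap.smul_apply,
        smul_eq_mul]
      ring
    refine ⟨ε, hε, fun t ht => ⟨?_, ?_⟩⟩
    · rw [hval h t ht]
      exact ENNReal.ofReal_ne_top
    · rw [hval h t ht, hval h' t ht]
  have hinv : ∀ S : Measure V.herm, (S.withDensity f).withDensity f⁻¹ = S := fun S =>
    withDensity_inv_same hfm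
      (Filter.Eventually.of_forall fun Z => (ENNReal.ofReal_pos.2 (Real.exp_pos _)).ne')
      (Filter.Eventually.of_forall fun Z => ENNReal.ofReal_ne_top)
  rw [← hinv R, key, hinv R']

end VinbergAlgebra

theorem LinearMap.hasFDerivAt_apply_self {E F : Type*} [NormedAddCommGroup E] [NormedSpace ℝ E]
    [FiniteDimensional ℝ E] [NormedAddCommGroup F] [NormedSpace ℝ F] (B : E →ₗ[ℝ] E →ₗ[ℝ] F)
    (x : E) :
    HasFDerivAt (fun x => B x x) (LinearMap.toContinuousLinearMap (B x + B.flip x)) x := by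
  have h := B.toContinuousBilinearMap.hasFDerivAt_of_bilinear (hasFDerivAt_id x) (hasFDerivAt_id x)
  refine h.congr_fderiv ?_
  ext u
  simp

namespace VinbergAlgebra

open VinbergData

variable {I : Type*} [Fintype I] [PartialOrder I] {A : I → I → Type*}
  [∀ i j, NormedAddCommGroup (A i j)] [∀ i j, InnerProductSpace ℝ (A i j)]
  [∀ i j, FiniteDimensional ℝ (A i j)] (V : VinbergAlgebra A)

/-! ### Changes of variables -/

theorem isOpen_posSet : IsOpen V.posSet := by
  have : V.posSet = ⋂ i, {x | 0 < V.diagEntry i x} := by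
    ext x
    simp [posSet]
  rw [this]
  exact isOpen_iInter_of_finite fun i => isOpen_lt continuous_const (V.continuous_diagEntry i)

variable [∀ i j, MeasurableSpace (A i j)] [∀ i j, BorelSpace (A i j)]

theorem measurableSet_posSet : MeasurableSet V.posSet := V.isOpen_posSet.measurableSet

theorem measurableEmbedding_lowerCoords : MeasurableEmbedding V.lowerCoords :=
  Continuous.measurableEmbedding (LinearMap.continuous_of_finiteDimensional V.coordsLin)
    V.coordsLin_injective

open Classical in
theorem measurePreserving_lowerCoords : MeasurePreserving V.lowerCoords V.lebesgue volume := by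
  have hemb := V.measurableEmbedding_lowerCoords
  have hrange : Set.range V.lowerCoords = Set.univ := V.coordsLin_surjective.range_eq
  refine ⟨hemb.measurable, ?_⟩
  rw [lebesgue, hemb.map_comap, hrange, Measure.restrict_univ]

open Classical in
/-- The change of variables `Z = x x^*`. -/
theorem setLIntegral_cone (F : V.herm → ENNReal) : ∫⁻ Z in V.cone, F Z ∂V.lebesgue =
    ∫⁻ x in V.posSet, ENNReal.ofReal (∏ i, 2 * V.diagEntry i x ^ (1 + V.nCol i)) *
      F (V.hermSq x) := by
  have himg : V.lowerCoords '' V.cone = (fun x => V.sqBilin x x) '' V.posSet := by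
    ext y
    constructor
    · rintro ⟨Z, hZ, rfl⟩
      obtain ⟨x, hx, rfl⟩ := V.mem_cone_iff.1 hZ
      exact ⟨x, hx, rfl⟩
    · rintro ⟨x, hx, rfl⟩
      exact ⟨V.hermSq x, V.mem_cone_iff.2 ⟨x, hx, rfl⟩, rfl⟩
  have h := V.measurePreserving_lowerCoords.setLIntegral_comp_emb
    V.measurableEmbedding_lowerCoords (fun y => F (V.coordsEquiv.symm y)) V.cone
  have hsymm : ∀ Z, V.coordsEquiv.symm (V.lowerCoords Z) = Z := V.coordsEquiv.symm_apply_apply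
  simp only [hsymm] at h
  rw [h, himg, lintegral_image_eq_lintegral_abs_det_fderiv_mul volume V.measurableSet_posSet
    (fun x _ => (V.sqBilin.hasFDerivAt_apply_self x).hasFDerivWithinAt)
    (fun x hx y hy hxy => V.hermSq_injOn hx hy (V.coordsLin_injective hxy))]
  refine setLIntegral_congr_fun V.measurableSet_posSet fun x hx => ?_
  have hdet : (LinearMap.toContinuousLinearMap (V.sqBilin x + V.sqBilin.flip x)).det =
      LinearMap.det (V.sqDeriv x) := LinearMap.det_toContinuousLinearMap _
  simp only [hdet]
  rw [abs_of_pos (V.det_sqDeriv_pos hx), det_sqDeriv, ← V.lowerCoords_hermSq, hsymm]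

open Classical in
/-- The behaviour of Lebesgue measure under left multiplication. -/
theorem setLIntegral_posSet_eq_lowMul (F : LowSp A → ENNReal) {g : LowSp A} (hg : g ∈ V.posSet) :
    ∫⁻ x in V.posSet, F x = ENNReal.ofReal (∏ i, V.diagEntry i g ^ (1 + V.nRow i)) *
      ∫⁻ x in V.posSet, F (V.lowMul g x) := by
  have himg : V.lowMul g '' V.posSet = V.posSet := by
    ext y
    constructor
    · rintro ⟨x, hx, rfl⟩
      exact V.lowMul_mem_posSet hg hx
    · intro hy
      refine ⟨((⟨g, hg⟩⁻¹ * ⟨y, hy⟩ : V.posSet) : LowSp A), Subtype.property _, ?_⟩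
      exact congrArg Subtype.val (mul_inv_cancel_left (⟨g, hg⟩ : V.posSet) ⟨y, hy⟩)
  have hinj : Function.Injective (V.lowMul g) :=
    (LinearMap.equivOfDetNeZero _ (V.det_lowMul_pos hg).ne').injective
  have hdet : (LinearMap.toContinuousLinearMap (V.lowMul g)).det =
      LinearMap.det (V.lowMul g) := LinearMap.det_toContinuousLinearMap _
  have h := lintegral_image_eq_lintegral_abs_det_fderiv_mul (f := V.lowMul g) volume
    V.measurableSet_posSet
    (fun x _ => (LinearMap.toContinuousLinearMap (V.lowMul g)).hasFDerivWithinAt) hinj.injOn F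
  rw [himg] at h
  rw [h, hdet, abs_of_pos (V.det_lowMul_pos hg), det_lowMul,
    lintegral_const_mul' _ _ ENNReal.ofReal_ne_top]

/-! ### The Gaussian integral over lower triangular matrices -/

theorem measurePreserving_scal (i : I) : MeasurePreserving (V.scal i) := by
  let e : A i i ≃ₗᵢ[ℝ] ℝ := ⟨V.scal i, fun a => by rw [norm_diag, Real.norm_eq_abs]⟩
  exact e.measurePreserving

theorem setLIntegral_diag (i : I) (a : ℝ) :
    ∫⁻ u in {u : A i i | 0 < V.scal i u},
      ENNReal.ofReal (V.scal i u ^ a * Real.exp (-‖u‖ ^ 2)) =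
    ∫⁻ t in Set.Ioi (0 : ℝ), ENNReal.ofReal (t ^ a * Real.exp (-t ^ 2)) := by
  have h := (V.measurePreserving_scal i).setLIntegral_comp_preimage (s := Set.Ioi 0)
    measurableSet_Ioi (f := fun t => ENNReal.ofReal (t ^ a * Real.exp (-t ^ 2))) (by fun_prop)
  rw [← h]
  refine lintegral_congr fun u => ?_
  rw [norm_diag, sq_abs]

-- Domain and integrand are products over the entries, so Tonelli applies. Each off-diagonal entry
-- contributes π^(dim/2), and these exponents add up to ∑ n_{i·}/2.
open Classical in
theorem setLIntegral_posSet_prod (a : I → ℝ) :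
    ∫⁻ x in V.posSet, ENNReal.ofReal ((∏ i, V.diagEntry i x ^ a i) * Real.exp (-V.sqNorm x)) =
      (∏ i, ∫⁻ t in Set.Ioi (0 : ℝ), ENNReal.ofReal (t ^ a i * Real.exp (-t ^ 2))) *
        ENNReal.ofReal (Real.pi ^ (((∑ i, V.nRow i : ℕ) : ℝ) / 2)) := by
  -- A functional on every `A i j` that is the scalar identification when i = j and zero otherwise
  -- (the (j, i) entry of the unit vanishes). Being total in i and j, it avoids transport along i =
  -- j.
  let ℓ : ∀ i j, A i j →ₗ[ℝ] ℝ := fun i j =>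
    (V.scal i).toLinearMap ∘ₗ (V.emul i j i).flip (V.one j i)
  have hℓ : ∀ i (u : A i i), ℓ i i u = V.scal i u := fun i u => by
    change V.scal i (V.emul i i i u (V.one i i)) = _
    rw [one_apply_self, emul_diag_right, LinearEquiv.apply_symm_apply, one_smul]
  let s : ∀ i j, Set (A i j) := fun i j => {u | i = j → 0 < ℓ i j u}
  let c : ∀ i j, A i j → ℝ := fun i j u => if i = j then ℓ i j u ^ a i else 1
  let f : ∀ i j, A i j → ENNReal := fun i j u => ENNReal.ofReal (c i j u * Real.exp (-‖u‖ ^ 2))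
  have hℓm : ∀ i j, Measurable (ℓ i j) := fun i j =>
    (LinearMap.continuous_of_finiteDimensional (ℓ i j)).measurable
  have hf : ∀ i j, Measurable (f i j) := fun i j => by
    have hc : Measurable (c i j) := by
      by_cases h : i = j
      · simp only [c, h, if_true]
        exact (hℓm _ _).pow_const _
      · simp only [c, h, if_false]
        exact measurable_const
    exact (hc.mul (Real.measurable_exp.comp (measurable_norm.pow_const 2).neg)).ennreal_ofReal
  have hpos : V.posSet = Set.univ.pi fun p : {p : I × I // p.2 ≤ p.1} => s p.1.1 p.1.2 := by
    ext x
    simp only [posSet, Set.mem_pi, Set.mem_univ, forall_const, s]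
    constructor
    · rintro hx ⟨⟨i, j⟩, hij⟩ h
      dsimp only at h
      subst h
      exact (hℓ i _).symm ▸ hx i
    · intro hx i
      have := hx ⟨(i, i), le_rfl⟩ rfl
      exact (hℓ i _) ▸ this
  have hint : ∀ x ∈ V.posSet,
      ENNReal.ofReal ((∏ i, V.diagEntry i x ^ a i) * Real.exp (-V.sqNorm x)) =
        ∏ p : {p : I × I // p.2 ≤ p.1}, f p.1.1 p.1.2 (x p) := by
    intro x hx
    have hcnn : ∀ p : {p : I × I // p.2 ≤ p.1}, 0 ≤ c p.1.1 p.1.2 (x p) := by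
      rintro ⟨⟨i, j⟩, hij⟩
      by_cases h : i = j
      · subst h
        simp only [c, if_true]
        exact Real.rpow_nonneg ((hℓ i _).symm ▸ (hx i).le) _
      · simp [c, h]
    rw [← ENNReal.ofReal_prod_of_nonneg fun p _ => mul_nonneg (hcnn p) (Real.exp_pos _).le,
      Finset.prod_mul_distrib, ← Real.exp_sum, sqNorm_eq, Finset.sum_neg_distrib]
    congr 2
    have h1 : ∏ p : {p : I × I // p.2 ≤ p.1}, c p.1.1 p.1.2 (x p) =
        ∏ p : {p : I × I // p.2 ≤ p.1}, c p.1.1 p.1.2 (lowExt x p.1.1 p.1.2) :=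
      Finset.prod_congr rfl fun p _ => by rw [lowExt_of_le x p.2]
    rw [h1, prod_lower_eq_prod_row fun i j => c i j (lowExt x i j)]
    refine Finset.prod_congr rfl fun i _ => ?_
    rw [Finset.prod_eq_one, _root_.mul_one]
    · simp only [c, if_true]
      rw [hℓ, scal_lowExt]
    · intro j hj
      simp [c, (Finset.mem_filter.1 hj).2.ne']
  rw [setLIntegral_congr_fun V.measurableSet_posSet hint, hpos, volume_pi,
    Measure.restrict_pi_pi,
    lintegral_pi_prod_eq_prod (fun p : {p : I × I // p.2 ≤ p.1} => f p.1.1 p.1.2)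
      fun p => hf _ _,
    prod_lower_eq_prod_row fun i j => ∫⁻ u in s i j, f i j u, Finset.prod_mul_distrib]
  congr 1
  · refine Finset.prod_congr rfl fun i _ => ?_
    rw [← V.setLIntegral_diag i]
    simp only [s, f, c, if_true, forall_const, hℓ]
  · have hoff : ∀ i, ∀ j ∈ Finset.univ.filter (· < i), ∫⁻ u in s i j, f i j u =
        ENNReal.ofReal (Real.pi ^ ((Module.finrank ℝ (A i j) : ℝ) / 2)) := by
      intro i j hj
      have hne : i ≠ j := (Finset.mem_filter.1 hj).2.ne'
      have hs : s i j = Set.univ := by simp [s, hne]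
      rw [hs, Measure.restrict_univ, ← lintegral_exp_neg_norm_sq]
      simp only [f, c, hne, if_false, _root_.one_mul]
    rw [Finset.prod_congr rfl fun i _ => Finset.prod_congr rfl (hoff i)]
    have hp : ∀ r : ℝ, 0 ≤ Real.pi ^ r := fun r => (Real.rpow_pos_of_pos Real.pi_pos r).le
    simp only [nRow, Nat.cast_sum, Finset.sum_div, Real.rpow_sum_of_pos Real.pi_pos]
    rw [ENNReal.ofReal_prod_of_nonneg fun i _ => Finset.prod_nonneg fun j _ => hp _]
    refine Finset.prod_congr rfl fun i _ => ?_
    rw [ENNReal.ofReal_prod_of_nonneg fun j _ => hp _]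

end VinbergAlgebra

namespace VinbergAlgebra

open VinbergData

variable {I : Type*} [Fintype I] [PartialOrder I] {A : I → I → Type*}
  [∀ i j, NormedAddCommGroup (A i j)] [∀ i j, InnerProductSpace ℝ (A i j)]

/-! ### The Laplace transform of the density -/

open Classical in
theorem sum_nCol (V : VinbergAlgebra A) : ∑ i, V.nCol i = ∑ i, V.nRow i := by
  simp only [nCol, nRow]
  exact Finset.sum_comm' (by simp)

theorem nTot_sub_card (V : VinbergAlgebra A) :
    V.nTot - Fintype.card I = ((∑ i, V.nRow i : ℕ) : ℝ) := by
  have h : ((∑ i, V.nCol i : ℕ) : ℝ) = ((∑ i, V.nRow i : ℕ) : ℝ) := by rw [sum_nCol]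
  simp only [nTot, nVal, Finset.sum_add_distrib, Finset.sum_const, Finset.card_univ, nsmul_eq_mul,
    _root_.mul_one, ← Finset.sum_div]
  push_cast at h ⊢
  rw [h]
  ring

theorem range_hermSq (V : VinbergAlgebra A) :
    Set.range (fun g : V.posSet => V.hermSq g) = V.cone := by
  ext Z
  rw [mem_cone_iff]
  exact ⟨fun ⟨g, hg⟩ => ⟨g, g.2, hg⟩, fun ⟨x, hx, h⟩ => ⟨⟨x, hx⟩, h⟩⟩

variable [∀ i j, FiniteDimensional ℝ (A i j)] [∀ i j, MeasurableSpace (A i j)]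
  [∀ i j, BorelSpace (A i j)] (V : VinbergAlgebra A)

theorem measurable_diagEntry (i : I) : Measurable (V.diagEntry i) :=
  (V.continuous_diagEntry i).measurable

instance : StandardBorelSpace V.posSet := V.measurableSet_posSet.standardBorel

/-- By the Lusin–Souslin theorem an injective measurable map from a standard Borel space is an
embedding. Hence the cone is Borel and measures move freely between it and the group. -/
theorem measurableEmbedding_hermSq : MeasurableEmbedding fun g : V.posSet => V.hermSq g :=
  (V.continuous_hermSq.comp continuous_subtype_val).measurable.measurableEmbedding
    fun g h hgh => Subtype.ext (V.hermSq_injOn g.2 h.2 hgh)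

theorem measurableSet_cone : MeasurableSet V.cone :=
  V.range_hermSq ▸ V.measurableEmbedding_hermSq.measurableSet_range

/-- The generalized power rests on a choice and is uncontrolled off the cone; on the cone it is
transported from an explicit measurable function on the group. -/
theorem measurable_indicator_genPower (c : ℝ) (χ : I → ℝ) :
    Measurable (V.cone.indicator fun Z => ENNReal.ofReal (c * V.genPower χ Z)) := by
  have h : (V.cone.indicator fun Z => ENNReal.ofReal (c * V.genPower χ Z)) =
      Function.extend (fun g : V.posSet => V.hermSq g)
        (fun g => ENNReal.ofReal (c * ∏ i, (V.diagEntry i g ^ 2) ^ χ i)) 0 := by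
    ext Z
    by_cases hZ : Z ∈ V.cone
    · obtain ⟨x, hx, rfl⟩ := V.mem_cone_iff.1 hZ
      rw [Set.indicator_of_mem hZ, V.genPower_hermSq χ hx]
      exact (V.measurableEmbedding_hermSq.injective.extend_apply
        (fun g : V.posSet => ENNReal.ofReal (c * ∏ i, (V.diagEntry i (g : LowSp A) ^ 2) ^ χ i))
        0 ⟨x, hx⟩).symm
    · rw [Set.indicator_of_notMem hZ, Function.extend_apply', Pi.zero_apply]
      rintro ⟨g, rfl⟩
      exact hZ (V.mem_cone_iff.2 ⟨g, g.2, rfl⟩)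
  rw [h]
  refine V.measurableEmbedding_hermSq.measurable_extend ?_ measurable_const
  refine (measurable_const.mul (Finset.measurable_prod _ fun i _ => ?_)).ennreal_ofReal
  exact (((V.measurable_diagEntry i).comp measurable_subtype_coe).pow_const 2).pow_const _

open Classical in
theorem isRiesz_withDensity {χ : I → ℝ} (hχ : ∀ i, (V.nRow i : ℝ) / 2 < χ i) :
    V.IsRiesz χ (V.lebesgue.withDensity (V.cone.indicator fun Z =>
        ENNReal.ofReal ((V.gammaCone χ)⁻¹ * V.genPower (fun i => χ i + -V.nVal i) Z))) := by
  refine ⟨?_, fun θ hθ => ?_⟩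
  · rw [withDensity_apply _ isClosed_closure.measurableSet.compl]
    refine (setLIntegral_congr_fun isClosed_closure.measurableSet.compl
      fun Z hZ => Set.indicator_of_notMem (fun h => hZ (subset_closure h)) _).trans ?_
    simp
  obtain ⟨q, hq, rfl⟩ := V.exists_dualSq_of_mem_dualCone hθ
  have hG : ∀ i, 0 < Real.Gamma (χ i - (V.nRow i : ℝ) / 2) := fun i =>
    Real.Gamma_pos_of_pos (sub_pos.2 (hχ i))
  have hΓ : 0 < V.gammaCone χ :=
    mul_pos (Real.rpow_pos_of_pos Real.pi_pos _) (Finset.prod_pos fun i _ => hG i)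
  -- Exponent of x_ii: the Jacobian gives 1 + n_{·i} and the density gives 2(λ_i - n_i), so n_{·i}
  -- cancels.
  set a : I → ℝ := fun i => 2 * χ i - 1 - V.nRow i with ha
  set H : LowSp A → ENNReal := fun y =>
    ENNReal.ofReal ((∏ i, V.diagEntry i y ^ a i) * Real.exp (-V.sqNorm y)) with hH
  -- The factor paid for writing the integrand as a function of qx; the twos come from the Jacobian
  -- and later cancel the halves of the Gamma integrals.
  set K : ℝ := (V.gammaCone χ)⁻¹ * ∏ i, (2 * V.diagEntry i q ^ (-a i)) with hK
  have hKpos : 0 < K := mul_pos (inv_pos.2 hΓ) (Finset.prod_pos fun i _ =>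
    mul_pos two_pos (Real.rpow_pos_of_pos (hq i) _))
  simp only [← V.trPairing_apply]
  rw [lintegral_withDensity_eq_lintegral_mul _ (V.measurable_indicator_genPower _ _)
    (V.measurable_exp_neg_trPairing (V.dualSq q))]
  have h1 : ∀ Z, (V.cone.indicator (fun Z =>
        ENNReal.ofReal ((V.gammaCone χ)⁻¹ * V.genPower (fun i => χ i + -V.nVal i) Z)) *
      fun Z : V.herm => ENNReal.ofReal (Real.exp (-V.trPairing (V.dualSq q) Z))) Z =
      V.cone.indicator (fun Z : V.herm =>
        ENNReal.ofReal ((V.gammaCone χ)⁻¹ * V.genPower (fun i => χ i + -V.nVal i) Z) *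
        ENNReal.ofReal (Real.exp (-V.trPairing (V.dualSq q) Z))) Z := fun Z => by
    by_cases hZ : Z ∈ V.cone <;> simp [hZ]
  rw [lintegral_congr h1, lintegral_indicator V.measurableSet_cone, setLIntegral_cone]
  have h2 : ∀ x ∈ V.posSet, ENNReal.ofReal (∏ i, 2 * V.diagEntry i x ^ (1 + V.nCol i)) *
      (ENNReal.ofReal ((V.gammaCone χ)⁻¹ *
        V.genPower (fun i => χ i + -V.nVal i) (V.hermSq x)) *
        ENNReal.ofReal (Real.exp (-V.trPairing (V.dualSq q) (V.hermSq x)))) =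
      ENNReal.ofReal K * H (V.lowMul q x) := by
    intro x hx
    rw [V.genPower_hermSq _ hx, trPairing_apply, tr_dualSq_mul_hermSq, hH]
    have hp1 : 0 ≤ ∏ i, 2 * V.diagEntry i x ^ (1 + V.nCol i) :=
      Finset.prod_nonneg fun i _ => mul_nonneg two_pos.le (pow_pos (hx i) _).le
    have hp2 : 0 ≤ (V.gammaCone χ)⁻¹ * ∏ i, (V.diagEntry i x ^ 2) ^ (χ i + -V.nVal i) :=
      mul_nonneg (inv_pos.2 hΓ).le (Finset.prod_nonneg fun i _ =>
        Real.rpow_nonneg (sq_nonneg _) _)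
    rw [← ENNReal.ofReal_mul hp2, ← ENNReal.ofReal_mul hp1, ← ENNReal.ofReal_mul hKpos.le]
    congr 1
    rw [← mul_assoc, ← mul_assoc K]
    congr 1
    rw [hK, mul_left_comm, mul_assoc, ← Finset.prod_mul_distrib, ← Finset.prod_mul_distrib]
    congr 1
    refine Finset.prod_congr rfl fun i _ => ?_
    have hx' := hx i
    have hq' := hq i
    rw [diagEntry_lowMul, Real.mul_rpow hq'.le hx'.le, mul_assoc, mul_assoc, ← mul_assoc (_ ^ _),
      ← Real.rpow_add hq', neg_add_cancel, Real.rpow_zero, _root_.one_mul, ← Real.rpow_natCast,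
      ← Real.rpow_natCast, ← Real.rpow_mul hx'.le, ← Real.rpow_add hx']
    congr 2
    simp only [ha, nVal]
    push_cast
    ring
  rw [setLIntegral_congr_fun V.measurableSet_posSet h2,
    lintegral_const_mul' _ _ ENNReal.ofReal_ne_top]
  have h3 := V.setLIntegral_posSet_eq_lowMul H hq
  rw [hH, V.setLIntegral_posSet_prod a, ← hH] at h3
  have h4 : ∀ i, ∫⁻ t in Set.Ioi (0 : ℝ), ENNReal.ofReal (t ^ a i * Real.exp (-t ^ 2)) =
      ENNReal.ofReal (1 / 2 * Real.Gamma (χ i - (V.nRow i : ℝ) / 2)) := fun i => by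
    rw [lintegral_rpow_mul_exp_neg_sq]
    · congr 3
      simp only [ha]
      ring
    · simp only [ha]
      linarith [hχ i]
  simp only [h4] at h3
  have hG' : ∀ i, 0 ≤ 1 / 2 * Real.Gamma (χ i - (V.nRow i : ℝ) / 2) := fun i =>
    mul_nonneg (by norm_num) (hG i).le
  rw [← ENNReal.ofReal_prod_of_nonneg fun i _ => hG' i,
    ← ENNReal.ofReal_mul (Finset.prod_nonneg fun i _ => hG' i)] at h3
  set D : ℝ := ∏ i, V.diagEntry i q ^ (1 + V.nRow i) with hD
  have hDpos : 0 < D := Finset.prod_pos fun i _ => pow_pos (hq i) _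
  have h5 : ENNReal.ofReal D⁻¹ * ENNReal.ofReal D = 1 := by
    rw [← ENNReal.ofReal_mul (inv_pos.2 hDpos).le, inv_mul_cancel₀ hDpos.ne', ENNReal.ofReal_one]
  have h6 := congrArg (fun z => ENNReal.ofReal D⁻¹ * z) h3
  rw [← mul_assoc, h5, _root_.one_mul, ← ENNReal.ofReal_mul (inv_pos.2 hDpos).le] at h6
  rw [← h6, ← ENNReal.ofReal_mul hKpos.le, V.genPower_dualInv χ ⟨q, hq⟩]
  congr 1
  have hπ := Real.rpow_pos_of_pos Real.pi_pos (((∑ i, V.nRow i : ℕ) : ℝ) / 2)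
  have hprod : ∏ i, ((V.diagEntry i q)⁻¹ ^ 2) ^ χ i =
      (∏ i, (2 * V.diagEntry i q ^ (-a i))) * D⁻¹ * ∏ _i : I, (1 / 2 : ℝ) := by
    rw [hD, ← Finset.prod_inv_distrib, ← Finset.prod_mul_distrib, ← Finset.prod_mul_distrib]
    refine Finset.prod_congr rfl fun i _ => ?_
    have hq' := hq i
    rw [inv_pow, Real.inv_rpow (sq_nonneg _), ← Real.rpow_natCast, ← Real.rpow_natCast,
      ← Real.rpow_mul hq'.le, ← Real.rpow_neg hq'.le, ← Real.rpow_neg hq'.le, mul_assoc 2,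
      ← Real.rpow_add hq', mul_comm 2, mul_assoc, mul_one_div_cancel two_ne_zero,
      _root_.mul_one]
    congr 1
    simp only [ha]
    push_cast
    ring
  have hGp : 0 < ∏ i, Real.Gamma (χ i - (V.nRow i : ℝ) / 2) := Finset.prod_pos fun i _ => hG i
  have hsplit : ∏ i, (1 / 2 * Real.Gamma (χ i - (V.nRow i : ℝ) / 2)) =
      (∏ _i : I, (1 / 2 : ℝ)) * ∏ i, Real.Gamma (χ i - (V.nRow i : ℝ) / 2) :=
    Finset.prod_mul_distrib
  rw [hprod, hK, gammaCone, nTot_sub_card, hsplit]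
  generalize ∏ i, Real.Gamma (χ i - (V.nRow i : ℝ) / 2) = G at hGp
  generalize ∏ _i : I, (1 / 2 : ℝ) = Y
  generalize ∏ i, (2 * V.diagEntry i q ^ (-a i)) = X
  field_simp

/-! ### Riesz measures with a density -/

instance : MeasurableMul₂ V.posSet :=
  ⟨((V.continuous_lowMul.comp ((continuous_subtype_val.comp continuous_fst).prodMk
    (continuous_subtype_val.comp continuous_snd))).subtype_mk _).measurable⟩

/-- The pairs with product 1 form a Borel set whose first projection is injective, hence a
measurable embedding; preimages under inversion are images under it. -/
instance : MeasurableInv V.posSet := by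
  refine ⟨?_⟩
  let S : Set (V.posSet × V.posSet) := {p | p.1 * p.2 = 1}
  have hS : MeasurableSet S :=
    measurableSet_eq_fun measurable_mul measurable_const
  have : StandardBorelSpace S := hS.standardBorel
  let f : S → V.posSet := fun p => p.1.1
  have hf : Measurable f := measurable_fst.comp measurable_subtype_coe
  have hinj : Function.Injective f := by
    rintro ⟨⟨a, b⟩, hab⟩ ⟨⟨a', b'⟩, hab'⟩ h
    change a = a' at h
    subst h
    have h1 : b = a⁻¹ := eq_inv_of_mul_eq_one_right hab
    have h2 : b' = a⁻¹ := eq_inv_of_mul_eq_one_right hab'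
    rw [Subtype.mk.injEq, h1, h2]
  have hemb := hf.measurableEmbedding hinj
  intro s hs
  have : (fun g : V.posSet => g⁻¹) ⁻¹' s = f '' {p | p.1.2 ∈ s} := by
    ext g
    constructor
    · intro hg
      exact ⟨⟨(g, g⁻¹), mul_inv_cancel g⟩, hg, rfl⟩
    · rintro ⟨⟨⟨a, b⟩, hab⟩, hb, rfl⟩
      have h1 : b = a⁻¹ := eq_inv_of_mul_eq_one_right hab
      exact h1 ▸ hb
  rw [this]
  exact hemb.measurableSet_image.2 ((measurable_snd.comp measurable_subtype_coe) hs)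

end VinbergAlgebra

/-- A relatively invariant measure on a group becomes invariant after division by its
multiplier. -/
theorem MeasureTheory.Measure.isMulLeftInvariant_withDensity_inv {G : Type*} [MeasurableSpace G]
    [Group G] [MeasurableMul₂ G] {m : Measure G} {δ : G → ℝ} (hδm : Measurable δ)
    (hδ : ∀ g, 0 < δ g) (hmul : ∀ g h, δ (g * h) = δ g * δ h)
    (hm : ∀ g, m = ENNReal.ofReal (δ g) • m.map (g * ·)) :
    (m.withDensity fun g => ENNReal.ofReal (δ g)⁻¹).IsMulLeftInvariant := by
  refine ⟨fun g => ?_⟩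
  have hw : Measurable fun g => ENNReal.ofReal (δ g)⁻¹ := hδm.inv.ennreal_ofReal
  ext s hs
  rw [Measure.map_apply (measurable_const_mul g) hs, withDensity_apply _ hs,
    withDensity_apply _ (measurable_const_mul g hs)]
  conv_rhs => rw [hm g]
  rw [Measure.restrict_smul, lintegral_smul_measure, smul_eq_mul,
    setLIntegral_map hs hw (measurable_const_mul g),
    ← lintegral_const_mul' _ _ ENNReal.ofReal_ne_top]
  refine lintegral_congr fun h => ?_
  rw [← ENNReal.ofReal_mul (hδ g).le, hmul, mul_inv, mul_inv_cancel_left₀ (hδ g).ne']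

namespace VinbergAlgebra

open VinbergData

variable {I : Type*} [Fintype I] [PartialOrder I] {A : I → I → Type*}
  [∀ i j, NormedAddCommGroup (A i j)] [∀ i j, InnerProductSpace ℝ (A i j)]
  (V : VinbergAlgebra A)

/-- The character `∏ (t_{ii}^2)^{λ_i}` of `𝒯_l^+`. -/
noncomputable def character (χ : I → ℝ) (g : V.posSet) : ℝ :=
  ∏ i, (V.diagEntry i (g : LowSp A) ^ 2) ^ χ i

theorem character_pos (χ : I → ℝ) (g : V.posSet) : 0 < V.character χ g :=
  Finset.prod_pos fun i _ => Real.rpow_pos_of_pos (pow_pos (g.2 i) 2) _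

/-- The density of the left Haar measure of `𝒯_l^+` is the inverse of this character. -/
noncomputable def haarFactor (g : V.posSet) : ℝ :=
  ∏ i, V.diagEntry i (g : LowSp A) ^ (1 + V.nRow i)

theorem haarFactor_pos (g : V.posSet) : 0 < V.haarFactor g :=
  Finset.prod_pos fun i _ => pow_pos (g.2 i) _

variable [∀ i j, FiniteDimensional ℝ (A i j)]

theorem character_mul (χ : I → ℝ) (g h : V.posSet) :
    V.character χ (g * h) = V.character χ g * V.character χ h := by
  rw [character, character, character, ← Finset.prod_mul_distrib]
  refine Finset.prod_congr rfl fun i _ => ?_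
  rw [coe_mul, diagEntry_lowMul, mul_pow, Real.mul_rpow (sq_nonneg _) (sq_nonneg _)]

theorem genPower_dualInv_eq_character (χ : I → ℝ) (g : V.posSet) :
    V.genPower χ (V.dualInv (V.dualSq (g : LowSp A))) = (V.character χ g)⁻¹ := by
  rw [genPower_dualInv, character, ← Finset.prod_inv_distrib]
  refine Finset.prod_congr rfl fun i _ => ?_
  rw [inv_pow, Real.inv_rpow (sq_nonneg _)]

theorem haarFactor_mul (g h : V.posSet) :
    V.haarFactor (g * h) = V.haarFactor g * V.haarFactor h := by
  rw [haarFactor, haarFactor, haarFactor, ← Finset.prod_mul_distrib]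
  refine Finset.prod_congr rfl fun i _ => ?_
  rw [coe_mul, diagEntry_lowMul, mul_pow]

variable [∀ i j, MeasurableSpace (A i j)] [∀ i j, BorelSpace (A i j)]

open Classical in
/-- The boundary of the cone is a null set. -/
theorem lebesgue_closure_diff_cone : V.lebesgue (closure V.cone \ V.cone) = 0 := by
  have hnull : volume {x : LowSp A | ∃ i, V.diagEntry i x = 0} = 0 := by
    have : {x : LowSp A | ∃ i, V.diagEntry i x = 0} =
        ⋃ i, ((LinearMap.ker (V.diagEntry i) : Submodule ℝ (LowSp A)) : Set (LowSp A)) := by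
      ext x
      simp
    rw [this]
    refine measure_iUnion_null fun i => Measure.addHaar_submodule _ _ fun h => ?_
    have h1 : V.lowOne ∈ LinearMap.ker (V.diagEntry i) := h ▸ Submodule.mem_top
    rw [LinearMap.mem_ker, diagEntry_lowOne] at h1
    exact one_ne_zero h1
  rw [lebesgue, V.measurableEmbedding_lowerCoords.comap_apply]
  -- A boundary point is x x^* with some x_ii = 0. Such x lie in finitely many hyperplanes, and a
  -- differentiable map of a space to itself preserves null sets.
  refine measure_mono_null ?_ (addHaar_image_eq_zero_of_differentiableOn_of_addHaar_eq_zero volume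
    (f := fun x => V.sqBilin x x)
    (fun x _ => (V.sqBilin.hasFDerivAt_apply_self x).differentiableAt.differentiableWithinAt) hnull)
  rintro _ ⟨Z, ⟨hZ, hZ'⟩, rfl⟩
  obtain ⟨x, hx, rfl⟩ := V.exists_hermSq_of_mem_closure hZ
  refine ⟨x, ?_, rfl⟩
  by_contra hne
  exact hZ' (V.mem_cone_iff.2 ⟨x, fun i => lt_of_le_of_ne (hx i) fun h => hne ⟨i, h.symm⟩, rfl⟩)

/-- The one place where the necessity argument uses absolute continuity: it excludes mass on the
boundary. -/
theorem measure_compl_cone {χ : I → ℝ} {R : Measure V.herm} (hR : V.IsRiesz χ R)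
    (hac : R ≪ V.lebesgue) : R V.coneᶜ = 0 := by
  refine measure_mono_null (t := (closure V.cone)ᶜ ∪ (closure V.cone \ V.cone)) ?_
    (measure_union_null hR.1 (hac V.lebesgue_closure_diff_cone))
  intro Z hZ
  by_cases h : Z ∈ closure V.cone
  · exact Or.inr ⟨h, hZ⟩
  · exact Or.inl h

theorem measurable_character (χ : I → ℝ) : Measurable (V.character χ) :=
  Finset.measurable_prod _ fun i _ =>
    (((V.measurable_diagEntry i).comp measurable_subtype_coe).pow_const 2).pow_const _

theorem measurable_ofReal_character_inv (χ : I → ℝ) :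
    Measurable fun g => ENNReal.ofReal (V.character χ g)⁻¹ :=
  (V.measurable_character χ).inv.ennreal_ofReal

/-- A measure on the group whose image is a Riesz measure is relatively invariant. -/
theorem eq_smul_map_mul_left {χ : I → ℝ} {m : Measure V.posSet}
    (hm : V.IsRiesz χ (m.map fun g : V.posSet => V.hermSq g)) (g : V.posSet) :
    m = ENNReal.ofReal (V.character χ g) • m.map (g * ·) := by
  have hemb := V.measurableEmbedding_hermSq
  set e : V.posSet → V.herm := fun g => V.hermSq g
  have hR : V.IsRiesz χ ((ENNReal.ofReal (V.character χ g) • m.map (g * ·)).map e) := by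
    constructor
    · rw [hemb.map_apply]
      have : e ⁻¹' (closure V.cone)ᶜ = ∅ := by
        ext h
        simp only [Set.mem_preimage, Set.mem_compl_iff, Set.mem_empty_iff_false, iff_false, not_not]
        exact subset_closure (V.mem_cone_iff.2 ⟨h, h.2, rfl⟩)
      rw [this, measure_empty]
    · intro θ hθ
      obtain ⟨q, hq, rfl⟩ := V.exists_dualSq_of_mem_dualCone hθ
      -- Translating by g moves the transform from q^*q to (qg)^*(qg), because q(gh) = (qg)h; the
      -- character then splits off the factor of g.
      have h1 := hm.2 (V.dualSq ((⟨q, hq⟩ * g : V.posSet) : LowSp A))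
        (V.dualSq_mem_dualCone (Subtype.property _))
      rw [hemb.lintegral_map, genPower_dualInv_eq_character, character_mul] at h1
      have hmeas : Measurable fun h : V.posSet =>
          ENNReal.ofReal (Real.exp (-V.tr (V.mul (V.dualSq q) (e h)))) := by
        simp only [← V.trPairing_apply]
        exact (V.measurable_exp_neg_trPairing (V.dualSq q)).comp hemb.measurable
      rw [hemb.lintegral_map, lintegral_smul_measure, smul_eq_mul,
        lintegral_map hmeas (measurable_const_mul g), V.genPower_dualInv_eq_character χ ⟨q, hq⟩]
      have h2 : ∀ h : V.posSet, V.tr (V.mul (V.dualSq q) (e (g * h))) =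
          V.tr (V.mul (V.dualSq ((⟨q, hq⟩ * g : V.posSet) : LowSp A)) (e h)) := fun h => by
        rw [tr_dualSq_mul_hermSq, tr_dualSq_mul_hermSq, coe_mul, coe_mul, lowMul_assoc]
      simp only [h2]
      rw [h1, ← ENNReal.ofReal_mul (V.character_pos χ g).le, mul_inv, mul_left_comm,
        mul_inv_cancel₀ (V.character_pos χ g).ne', _root_.mul_one]
  have h := hm.unique hR
  have h' := congrArg (Measure.comap e) h
  rwa [hemb.comap_map, hemb.comap_map] at h'

/-! ### Lebesgue and Haar measure on the triangular group -/

open Classical in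
/-- Lebesgue measure on the group `𝒯_l^+`. -/
noncomputable def groupVolume : Measure V.posSet := volume.comap Subtype.val

open Classical in
theorem map_val_groupVolume : V.groupVolume.map Subtype.val = volume.restrict V.posSet := by
  rw [groupVolume, (MeasurableEmbedding.subtype_coe V.measurableSet_posSet).map_comap,
    Subtype.range_coe]

open Classical in
theorem lintegral_groupVolume (F : LowSp A → ENNReal) :
    ∫⁻ g : V.posSet, F g ∂V.groupVolume = ∫⁻ x in V.posSet, F x := by
  rw [← map_val_groupVolume,
    (MeasurableEmbedding.subtype_coe V.measurableSet_posSet).lintegral_map]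

open Classical in
theorem groupVolume_eq_smul_map (g : V.posSet) :
    V.groupVolume = ENNReal.ofReal (∏ i, V.diagEntry i (g : LowSp A) ^ (1 + V.nRow i)) •
      V.groupVolume.map (g * ·) := by
  ext s hs
  have h := V.setLIntegral_posSet_eq_lowMul ((Subtype.val '' s).indicator 1) g.2
  rw [← lintegral_groupVolume, ← lintegral_groupVolume] at h
  have h1 : ∀ h : V.posSet, (Subtype.val '' s).indicator (1 : LowSp A → ENNReal) h =
      s.indicator 1 h := fun h => by
    by_cases hh : h ∈ s
    · rw [Set.indicator_of_mem hh, Set.indicator_of_mem (Set.mem_image_of_mem _ hh)]; rfl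
    · rw [Set.indicator_of_notMem hh, Set.indicator_of_notMem]
      rintro ⟨h', hs', he⟩
      exact hh (Subtype.ext he ▸ hs')
  simp only [← coe_mul, h1] at h
  rw [lintegral_indicator_one hs] at h
  rw [h, Measure.smul_apply, smul_eq_mul, Measure.map_apply (measurable_const_mul g) hs,
    ← lintegral_indicator_one (measurable_const_mul g hs)]
  rfl

theorem measurable_haarFactor : Measurable V.haarFactor :=
  Finset.measurable_prod _ fun i _ =>
    ((V.measurable_diagEntry i).comp measurable_subtype_coe).pow_const _

theorem measurable_ofReal_haarFactor_inv :
    Measurable fun g => ENNReal.ofReal (V.haarFactor g)⁻¹ :=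
  V.measurable_haarFactor.inv.ennreal_ofReal

/-- A left Haar measure of `𝒯_l^+`. -/
noncomputable def groupHaar : Measure V.posSet :=
  V.groupVolume.withDensity fun g => ENNReal.ofReal (V.haarFactor g)⁻¹

instance : V.groupHaar.IsMulLeftInvariant :=
  Measure.isMulLeftInvariant_withDensity_inv V.measurable_haarFactor V.haarFactor_pos
    V.haarFactor_mul V.groupVolume_eq_smul_map

instance : SigmaFinite V.groupVolume := by
  classical
  have : SigmaFinite (V.groupVolume.map Subtype.val) := by
    rw [map_val_groupVolume]
    infer_instance
  exact SigmaFinite.of_map _ measurable_subtype_coe.aemeasurable this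

instance : SigmaFinite V.groupHaar :=
  SigmaFinite.withDensity_of_ne_top
    (Filter.Eventually.of_forall fun _ => ENNReal.ofReal_ne_top)

theorem groupHaar_ne_zero : V.groupHaar ≠ 0 := by
  classical
  intro h
  rw [groupHaar, withDensity_eq_zero_iff V.measurable_ofReal_haarFactor_inv.aemeasurable]
    at h
  have h1 : V.groupVolume = 0 := by
    rw [← ae_eq_bot, ← Filter.eventually_false_iff_eq_bot]
    filter_upwards [h] with g hg
    exact (ENNReal.ofReal_pos.2 (inv_pos.2 (V.haarFactor_pos g))).ne' hg
  have h2 := V.map_val_groupVolume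
  rw [h1, Measure.map_zero] at h2
  have h3 := Measure.restrict_eq_zero.1 h2.symm
  exact (V.isOpen_posSet.measure_pos volume ⟨_, V.lowOne_mem_posSet⟩).ne' h3

theorem measurable_sqNorm : Measurable V.sqNorm := by
  have : Continuous V.sqNorm :=
    V.continuous_tr.comp (continuous_subtype_val.comp V.continuous_hermSq)
  exact this.measurable

theorem measurable_ofReal_character_mul_exp (χ : I → ℝ) :
    Measurable fun g : V.posSet =>
      ENNReal.ofReal (V.character χ g * Real.exp (-V.sqNorm g)) :=
  ((V.measurable_character χ).mul (Real.measurable_exp.comp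
    (V.measurable_sqNorm.comp measurable_subtype_coe).neg)).ennreal_ofReal

/-- An absolutely continuous Riesz measure forces the convergence of its Gamma integral. -/
theorem lintegral_groupHaar_ne_top {χ : I → ℝ} {R : Measure V.herm} (hR : V.IsRiesz χ R)
    (hac : R ≪ V.lebesgue) :
    ∫⁻ g, ENNReal.ofReal (V.character χ g * Real.exp (-V.sqNorm g)) ∂V.groupHaar ≠ ⊤ := by
  have hemb := V.measurableEmbedding_hermSq
  set m : Measure V.posSet := R.comap fun g => V.hermSq g with hmdef
  have hmap : m.map (fun g : V.posSet => V.hermSq g) = R := by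
    rw [hmdef, hemb.map_comap, V.range_hermSq]
    exact Measure.restrict_eq_self_of_ae_mem (mem_ae_iff.2 (V.measure_compl_cone hR hac))
  have hinv := Measure.isMulLeftInvariant_withDensity_inv (V.measurable_character χ)
    (V.character_pos χ) (V.character_mul χ) (V.eq_smul_map_mul_left (hmap ▸ hR))
  have hexp : ∫⁻ g : V.posSet, ENNReal.ofReal (Real.exp (-V.sqNorm g)) ∂m = 1 := by
    have h := hR.2 _ (V.dualSq_mem_dualCone V.lowOne_mem_posSet)
    rw [← hmap, hemb.lintegral_map] at h
    simp only [tr_dualSq_mul_hermSq, lowOne_lowMul] at h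
    rw [h, ← coe_one, genPower_dualInv_eq_character, character]
    simp [coe_one, diagEntry_lowOne]
  have hfm : Measurable fun g : V.posSet => ENNReal.ofReal (Real.exp (-V.sqNorm g)) :=
    (Real.measurable_exp.comp
      (V.measurable_sqNorm.comp measurable_subtype_coe).neg).ennreal_ofReal
  have hsf : SigmaFinite m := by
    have : IsFiniteMeasure (m.withDensity fun g => ENNReal.ofReal (Real.exp (-V.sqNorm g))) :=
      isFiniteMeasure_withDensity (hexp.trans_ne ENNReal.one_ne_top)
    rw [← withDensity_inv_same (μ := m) hfm
      (Filter.Eventually.of_forall fun g => (ENNReal.ofReal_pos.2 (Real.exp_pos _)).ne')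
      (Filter.Eventually.of_forall fun g => ENNReal.ofReal_ne_top)]
    refine SigmaFinite.withDensity_of_ne_top (Filter.Eventually.of_forall fun g => ?_)
    exact ENNReal.inv_ne_top.2 (ENNReal.ofReal_pos.2 (Real.exp_pos _)).ne'
  have hsf' : SigmaFinite (m.withDensity fun g => ENNReal.ofReal (V.character χ g)⁻¹) :=
    SigmaFinite.withDensity_of_ne_top
      (Filter.Eventually.of_forall fun _ => ENNReal.ofReal_ne_top)
  -- A set of positive finite Haar measure fixes the proportionality constant between two σ-finite
  -- left invariant measures.
  obtain ⟨n, hn⟩ : ∃ n, V.groupHaar (spanningSets V.groupHaar n) ≠ 0 := by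
    by_contra! hall
    apply V.groupHaar_ne_zero
    rw [← Measure.measure_univ_eq_zero, ← iUnion_spanningSets V.groupHaar]
    exact measure_iUnion_null hall
  have hsmul := measure_eq_div_smul (m.withDensity fun g => ENNReal.ofReal (V.character χ g)⁻¹)
    V.groupHaar hn (measure_spanningSets_lt_top _ n).ne
  have h1 : ∫⁻ g, ENNReal.ofReal (V.character χ g * Real.exp (-V.sqNorm g))
      ∂(m.withDensity fun g => ENNReal.ofReal (V.character χ g)⁻¹) = 1 := by
    rw [lintegral_withDensity_eq_lintegral_mul _ (V.measurable_ofReal_character_inv χ)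
      (V.measurable_ofReal_character_mul_exp χ), ← hexp]
    refine lintegral_congr fun g => ?_
    rw [Pi.mul_apply, ← ENNReal.ofReal_mul (inv_pos.2 (V.character_pos χ g)).le,
      inv_mul_cancel_left₀ (V.character_pos χ g).ne']
  rw [hsmul, lintegral_smul_measure, smul_eq_mul] at h1
  intro htop
  rw [htop] at h1
  -- If the Haar integral were infinite, its product with the constant would be 0 or ∞, whereas it
  -- equals 1.
  rcases eq_or_ne ((m.withDensity fun g => ENNReal.ofReal (V.character χ g)⁻¹)
    (spanningSets V.groupHaar n) / V.groupHaar (spanningSets V.groupHaar n)) 0 with h0 | h0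
  · rw [h0, zero_mul] at h1
    exact zero_ne_one h1
  · rw [ENNReal.mul_top h0] at h1
    exact ENNReal.top_ne_one h1

theorem nRow_div_two_lt_of_absolutelyContinuous {χ : I → ℝ} {R : Measure V.herm}
    (hR : V.IsRiesz χ R) (hac : R ≪ V.lebesgue) (i : I) : (V.nRow i : ℝ) / 2 < χ i := by
  classical
  have h := V.lintegral_groupHaar_ne_top hR hac
  rw [groupHaar, lintegral_withDensity_eq_lintegral_mul _
    V.measurable_ofReal_haarFactor_inv (V.measurable_ofReal_character_mul_exp χ)] at h
  have h1 : ∀ g : V.posSet, ((fun g => ENNReal.ofReal (V.haarFactor g)⁻¹) *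
      fun g : V.posSet => ENNReal.ofReal (V.character χ g * Real.exp (-V.sqNorm g))) g =
      (fun x : LowSp A => ENNReal.ofReal ((∏ i, V.diagEntry i x ^ (2 * χ i - (1 + V.nRow i))) *
        Real.exp (-V.sqNorm x))) g := fun g => by
    rw [Pi.mul_apply, ← ENNReal.ofReal_mul (inv_pos.2 (V.haarFactor_pos g)).le, ← mul_assoc]
    congr 2
    rw [haarFactor, character, ← Finset.prod_inv_distrib, ← Finset.prod_mul_distrib]
    refine Finset.prod_congr rfl fun i _ => ?_
    have hg := g.2 i
    rw [← Real.rpow_natCast, ← Real.rpow_natCast, ← Real.rpow_mul hg.le, ← Real.rpow_neg hg.le,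
      ← Real.rpow_add hg]
    congr 1
    push_cast
    ring
  have hval := (lintegral_congr h1).trans
    ((V.lintegral_groupVolume _).trans (V.setLIntegral_posSet_prod _))
  rw [hval] at h
  have hne : ∀ a : ℝ, ∫⁻ t in Set.Ioi (0 : ℝ), ENNReal.ofReal (t ^ a * Real.exp (-t ^ 2)) ≠ 0 := by
    intro a ha
    rw [lintegral_eq_zero_iff (by fun_prop)] at ha
    have h2 : ∀ᵐ t ∂(volume.restrict (Set.Ioi (0 : ℝ))), False := by
      filter_upwards [ha, ae_restrict_mem measurableSet_Ioi] with t ht ht0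
      exact (ENNReal.ofReal_pos.2 (mul_pos (Real.rpow_pos_of_pos ht0 a) (Real.exp_pos _))).ne' ht
    rw [Filter.eventually_false_iff_eq_bot, ae_eq_bot, Measure.restrict_eq_zero] at h2
    simp at h2
  have hfin : (∏ i, ∫⁻ t in Set.Ioi (0 : ℝ),
      ENNReal.ofReal (t ^ (2 * χ i - (1 + V.nRow i)) * Real.exp (-t ^ 2))) ≠ ⊤ := fun htop => by
    rw [htop, ENNReal.top_mul
      (ENNReal.ofReal_pos.2 (Real.rpow_pos_of_pos Real.pi_pos _)).ne'] at h
    exact h rfl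
  have hi : ∫⁻ t in Set.Ioi (0 : ℝ),
      ENNReal.ofReal (t ^ (2 * χ i - (1 + V.nRow i)) * Real.exp (-t ^ 2)) ≠ ⊤ := fun htop => by
    apply hfin
    rw [← Finset.mul_prod_erase _ _ (Finset.mem_univ i), htop, ENNReal.top_mul]
    -- No other factor vanishes, so a single divergent factor would make the whole product infinite.
    exact Finset.prod_ne_zero_iff.2 fun j _ => hne _
  have := neg_one_lt_of_lintegral_rpow_mul_exp_ne_top hi
  linarith

end VinbergAlgebra

theorem proposition3p5 {I : Type*} [Fintype I] [PartialOrder I] {A : I → I → Type*}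
    [∀ i j, NormedAddCommGroup (A i j)] [∀ i j, InnerProductSpace ℝ (A i j)]
    [∀ i j, FiniteDimensional ℝ (A i j)] [∀ i j, MeasurableSpace (A i j)]
    [∀ i j, BorelSpace (A i j)] (V : VinbergAlgebra A) (χ : I → ℝ) :
    (∀ R : Measure V.herm, V.IsRiesz χ R →
      (R ≪ V.lebesgue ↔ ∀ i, (V.nRow i : ℝ) / 2 < χ i)) ∧
    ((∀ i, (V.nRow i : ℝ) / 2 < χ i) → ∀ R : Measure V.herm, V.IsRiesz χ R ↔
      R = V.lebesgue.withDensity (V.cone.indicator fun Z =>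
        ENNReal.ofReal ((V.gammaCone χ)⁻¹ * V.genPower (fun i => χ i + -V.nVal i) Z))) := by
  refine ⟨fun R hR => ⟨fun hac i => V.nRow_div_two_lt_of_absolutelyContinuous hR hac i,
    fun hχ => ?_⟩, fun hχ R => ⟨fun hR => hR.unique (V.isRiesz_withDensity hχ), ?_⟩⟩
  · rw [hR.unique (V.isRiesz_withDensity hχ)]
    exact withDensity_absolutelyContinuous _ _
  · rintro rfl
    exact V.isRiesz_withDensity hχ
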